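/- Let $X_1,X_2,\dots$ be i.i.d. random variables with the law of $-\ln U+\frac1{2U^2}-\frac12$, where $U$ is uniform on $[0,1]$, and let $\varepsilon_0,\varepsilon_1,\varepsilon_2,\dots$ be symmetric $\pm1$-valued random variables, all the $X_i$ and $\varepsilon_i$ being independent. Put $S_k=\sum_{i=1}^kX_i$, $N_t=\sup\{k\ge0: S_k\le t\}$, $\overline F(x)=P(X_1>x)$ and $$Z^{(-1)}_t=\frac{\varepsilon_{N_t}}{\overline F(t-S_{N_t})},\qquad t\ge 0 .$$ Then, for every integer $n\ge1$, the process $Z^{(-1,n)}_t:=Z^{(-1)}_{nt}/\sqrt n$ is a time-homogeneous Markov process (with respect to its natural filtration) with generator $$L^{(-1,n)}g(x)=\frac{\frac12\left(g(-\frac1{\sqrt n})+g(\frac1{\sqrt n})\right)-g(x)+xg'(x)}{\frac1n+x^2}.$$ Precisely: there is a semigroup $(\kappa_t)_{t\ge0}$ of Markov transition kernels on $\mathbb R$ with $P(Z^{(-1,n)}_{s+t}\in B\mid Z^{(-1,n)}_u,\,u\le s)=\kappa_t(Z^{(-1,n)}_s,B)$ almost surely for all $s,t\ge0$ and Borel sets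 $B$. It is a Feller semigroup on the space $C_0(\mathbb R)$ of continuous functions vanishing at infinity. Its infinitesimal generator on $C_0(\mathbb R)$, defined by convergence of $(\kappa_tg-g)/t$ in supremum norm as $t\downarrow0$, is $g\mapsto L^{(-1,n)}g$, with domain the set of all $g\in C_0(\mathbb R)$ that are differentiable on $\mathbb R\setminus\{0\}$ and for which $L^{(-1,n)}g$, where $xg'(x)$ is read as $0$ at $x=0$, belongs to $C_0(\mathbb R)$. Moreover, for every differentiable $g:\mathbb R\to\mathbb R$ (bounded or not) and every $x\in\mathbb R$, $g$ is $\kappa_t(x,\cdot)$-integrable for all $t\ge 0$ and $\frac1t\left(\int g(y)\,\kappa_t(x,dy)-g(x)\right)\to L^{(-1,n)}g(x)$ as $t\downarrow0$. -/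

import Mathlib

open MeasureTheory ProbabilityTheory Filter Topology
open scoped NNReal ZeroAtInfty

noncomputable section

namespace AzemaRenewal

/-! ### The renewal process and the process `Z` -/

/-- The law of `-ln U + 1/(2U²) - 1/2`, where `U` is uniform on `[0,1]`. -/
def waitingLaw : Measure ℝ :=
  (volume.restrict (Set.Icc (0 : ℝ) 1)).map
    (fun u => -Real.log u + 1 / (2 * u ^ 2) - 1 / 2)

variable {Ω : Type*} [MeasurableSpace Ω]

/-- `S_k`, the sum of the first `k` waiting times (`X 0` is the first waiting time). -/
def renewalTime (X : ℕ → Ω → ℝ) (k : ℕ) (ω : Ω) : ℝ :=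
  ∑ i ∈ Finset.range k, X i ω

/-- `N_t = sup {k : S_k ≤ t}`. -/
def renewalCount (X : ℕ → Ω → ℝ) (t : ℝ≥0) (ω : Ω) : ℕ :=
  sSup {k : ℕ | renewalTime X k ω ≤ t}

/-- The tail function of the first waiting time, `x ↦ P(X 0 > x)`. -/
def tailProb (P : Measure Ω) (X : ℕ → Ω → ℝ) (x : ℝ) : ℝ :=
  P.real {ω | x < X 0 ω}

/-- `Z_t = ε_{N_t} / Fbar(t - S_{N_t})`. -/
def renewalZ (P : Measure Ω) (X ε : ℕ → Ω → ℝ) (t : ℝ≥0) (ω : Ω) : ℝ :=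
  ε (renewalCount X t ω) ω /
    tailProb P X ((t : ℝ) - renewalTime X (renewalCount X t ω) ω)

/-- The rescaled process `t ↦ Z_{nt} / √n`. -/
def rescaledZ (P : Measure Ω) (X ε : ℕ → Ω → ℝ) (n : ℕ) (t : ℝ≥0) (ω : Ω) : ℝ :=
  renewalZ P X ε (n * t) ω / √(n : ℝ)

/-- The random variables from which the process is built: iid waiting times with law
`waitingLaw`, and fair signs, all of them independent. -/
structure IsRenewalInput (P : Measure Ω) (X ε : ℕ → Ω → ℝ) : Prop where
  measurable_waiting : ∀ i, Measurable (X i)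
  measurable_sign : ∀ i, Measurable (ε i)
  law_waiting : ∀ i, P.map (X i) = waitingLaw
  sign_pos : ∀ i, P {ω | ε i ω = 1} = 1 / 2
  sign_neg : ∀ i, P {ω | ε i ω = -1} = 1 / 2
  indep : iIndepFun (Sum.elim X ε) P

/-! ### Markov processes, transition semigroups and generators -/

/-- A (conservative, time-homogeneous) transition semigroup on `E`. -/
structure IsTransitionSemigroup {E : Type*} [MeasurableSpace E]
    (κ : ℝ≥0 → Kernel E E) : Prop where
  markov : ∀ t, IsMarkovKernel (κ t)
  zero : κ 0 = Kernel.id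
  chapman_kolmogorov : ∀ s t, κ (s + t) = κ t ∘ₖ κ s

/-- The σ-algebra generated by `Y_u`, `u ≤ s`. -/
abbrev pastSigma {E : Type*} [mE : MeasurableSpace E] (Y : ℝ≥0 → Ω → E) (s : ℝ≥0) :
    MeasurableSpace Ω :=
  ⨆ u : Set.Iic s, mE.comap (Y u)

/-- `Y` is a Markov process, with respect to its natural filtration, with transition
semigroup `κ`: `P(Y_{s+t} ∈ B | Y_u, u ≤ s) = κ_t(Y_s, B)` almost surely. -/
structure IsMarkovProcess {E : Type*} [MeasurableSpace E] (P : Measure Ω)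
    (Y : ℝ≥0 → Ω → E) (κ : ℝ≥0 → Kernel E E) : Prop where
  measurable : ∀ t, Measurable (Y t)
  semigroup : IsTransitionSemigroup κ
  markov_property : ∀ (s t : ℝ≥0) (B : Set E), MeasurableSet B →
    P⟦(Y (s + t)) ⁻¹' B | pastSigma Y s⟧ =ᵐ[P] fun ω => (κ t (Y s ω)).real B

/-- The Feller property: the operators `f ↦ ∫ f(y) κ_t(·, dy)` map `C₀(E)` to itself and are
strongly continuous at time `0`. -/
structure IsFeller {E : Type*} [TopologicalSpace E] [MeasurableSpace E]
    (κ : ℝ≥0 → Kernel E E) : Prop where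
  maps_zeroAtInfty : ∀ (t : ℝ≥0) (f : C₀(E, ℝ)),
    ∃ F : C₀(E, ℝ), ∀ x, F x = ∫ y, f y ∂(κ t x)
  strongly_continuous : ∀ f : C₀(E, ℝ),
    TendstoUniformly (fun (t : ℝ≥0) (x : E) => ∫ y, f y ∂(κ t x)) f (𝓝[>] 0)

/-- `(g, h)` is in the graph of the infinitesimal generator of `κ` on `C₀(E)`: the difference
quotients `(κ_t g - g) / t` converge to `h` in the supremum norm as `t ↓ 0`. -/
def InGeneratorGraph {E : Type*} [TopologicalSpace E] [MeasurableSpace E]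
    (κ : ℝ≥0 → Kernel E E) (g h : C₀(E, ℝ)) : Prop :=
  TendstoUniformly (fun (t : ℝ≥0) (x : E) => ((∫ y, g y ∂(κ t x)) - g x) / (t : ℝ)) h (𝓝[>] 0)

/-- The operator
`g ↦ [½ (g(-1/√n) + g(1/√n)) - g(x) + x g'(x)] / (1/n + x²)`. -/
def genL (n : ℕ) (g : ℝ → ℝ) (x : ℝ) : ℝ :=
  (1 / 2 * (g (-(1 / √(n : ℝ))) + g (1 / √(n : ℝ))) - g x + x * deriv g x) /
    (1 / (n : ℝ) + x ^ 2)

end AzemaRenewal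

end

noncomputable section

namespace AzemaRenewal

/-! ### The deterministic flow and its cumulative hazard -/

/-- The time at which the cumulative hazard along the flow started from `x` reaches `h`. -/
def clock (c x h : ℝ) : ℝ := c * h + x ^ 2 * (Real.exp (2 * h) - 1) / 2

/-- The cumulative hazard up to time `t` along the flow started from `x`. -/
def cumHazard (c x t : ℝ) : ℝ := Function.invFun (clock c x) t

/-- The solution at time `t` of `y' = y / (c + y²)`, `y 0 = x`. -/
def flow (c x t : ℝ) : ℝ := x * Real.exp (cumHazard c x t)

/-- The density of the first jump time of the process started from `x`. -/
def jumpDensity (c x t : ℝ) : ℝ := Real.exp (-cumHazard c x t) / (c + flow c x t ^ 2)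

lemma clock_zero (c x : ℝ) : clock c x 0 = 0 := by simp [clock]

lemma clock_add (c x a b : ℝ) :
    clock c x (a + b) = clock c x a + clock c (x * Real.exp a) b := by
  have h1 : Real.exp (2 * (a + b)) = Real.exp a ^ 2 * Real.exp (2 * b) := by
    rw [← Real.exp_nat_mul, ← Real.exp_add]; congr 1; push_cast; ring
  have h2 : Real.exp (2 * a) = Real.exp a ^ 2 := by
    rw [← Real.exp_nat_mul]; norm_cast
  simp only [clock, h1, h2]; ring

lemma hasDerivAt_clock (c x h : ℝ) :
    HasDerivAt (clock c x) (c + (x * Real.exp h) ^ 2) h := by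
  have h2 : Real.exp (2 * h) = Real.exp h ^ 2 := by
    rw [← Real.exp_nat_mul]; norm_cast
  have h3 : HasDerivAt (fun h : ℝ => Real.exp (2 * h)) (Real.exp (2 * h) * (2 * 1)) h :=
    ((hasDerivAt_id h).const_mul 2).exp
  have := ((hasDerivAt_id h).const_mul c).add (((h3.sub_const 1).const_mul (x ^ 2)).div_const 2)
  exact this.congr_deriv (by rw [h2]; ring)

section

variable {c : ℝ} (hc : 0 < c)
include hc

lemma strictMono_clock (x : ℝ) : StrictMono (clock c x) := by
  intro a b hab
  have h1 : Real.exp (2 * a) ≤ Real.exp (2 * b) := Real.exp_le_exp.2 (by linarith)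
  have h2 : c * a < c * b := by gcongr
  have h3 : x ^ 2 * (Real.exp (2 * a) - 1) ≤ x ^ 2 * (Real.exp (2 * b) - 1) := by gcongr
  simp only [clock]; linarith

lemma surjective_clock (x : ℝ) : Function.Surjective (clock c x) := by
  refine Continuous.surjective (by unfold clock; fun_prop) ?_ ?_
  · refine tendsto_atTop_mono' _ ?_ (tendsto_id.const_mul_atTop hc)
    filter_upwards [eventually_ge_atTop 0] with h hh
    have : 0 ≤ x ^ 2 * (Real.exp (2 * h) - 1) :=
      mul_nonneg (sq_nonneg _) (sub_nonneg.2 (Real.one_le_exp (by linarith)))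
    simp only [clock, id]; linarith
  · refine tendsto_atBot_mono' _ ?_ (tendsto_id.const_mul_atBot hc)
    filter_upwards [eventually_le_atBot 0] with h hh
    have : 0 ≤ x ^ 2 * (1 - Real.exp (2 * h)) :=
      mul_nonneg (sq_nonneg _) (sub_nonneg.2 (Real.exp_le_one_iff.2 (by linarith)))
    simp only [clock, id]; linarith

lemma clock_cumHazard (x t : ℝ) : clock c x (cumHazard c x t) = t :=
  Function.rightInverse_invFun (surjective_clock hc x) t

lemma cumHazard_clock (x h : ℝ) : cumHazard c x (clock c x h) = h :=
  Function.leftInverse_invFun (strictMono_clock hc x).injective h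

lemma cumHazard_lt_iff {x t h : ℝ} : cumHazard c x t < h ↔ t < clock c x h := by
  rw [← (strictMono_clock hc x).lt_iff_lt, clock_cumHazard hc]

lemma lt_cumHazard_iff {x t h : ℝ} : h < cumHazard c x t ↔ clock c x h < t := by
  rw [← (strictMono_clock hc x).lt_iff_lt, clock_cumHazard hc]

lemma continuous_cumHazard : Continuous fun p : ℝ × ℝ => cumHazard c p.1 p.2 := by
  rw [continuous_iff_continuousAt]
  intro p
  refine tendsto_order.2 ⟨fun a ha => ?_, fun b hb => ?_⟩
  · simp only [lt_cumHazard_iff hc] at ha ⊢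
    exact (isOpen_lt (by unfold clock; fun_prop) (by fun_prop)).mem_nhds ha
  · simp only [cumHazard_lt_iff hc] at hb ⊢
    exact (isOpen_lt (by fun_prop) (by unfold clock; fun_prop)).mem_nhds hb

lemma continuous_cumHazard_right (x : ℝ) : Continuous (cumHazard c x) :=
  (continuous_cumHazard hc).comp (by fun_prop : Continuous fun t : ℝ => (x, t))

lemma continuous_cumHazard_left (t : ℝ) : Continuous fun x => cumHazard c x t :=
  (continuous_cumHazard hc).comp (by fun_prop : Continuous fun x : ℝ => (x, t))

lemma continuous_flow : Continuous fun p : ℝ × ℝ => flow c p.1 p.2 := by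
  have := continuous_cumHazard hc
  unfold flow; fun_prop

lemma continuous_flow_right (x : ℝ) : Continuous (flow c x) :=
  (continuous_flow hc).comp (by fun_prop : Continuous fun t : ℝ => (x, t))

lemma continuous_flow_left (t : ℝ) : Continuous fun x => flow c x t :=
  (continuous_flow hc).comp (by fun_prop : Continuous fun x : ℝ => (x, t))

lemma continuous_jumpDensity : Continuous fun p : ℝ × ℝ => jumpDensity c p.1 p.2 := by
  have h1 := continuous_cumHazard hc
  have h2 := continuous_flow hc
  unfold jumpDensity
  refine Continuous.div (by fun_prop) (by fun_prop) fun p => ?_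
  positivity

lemma continuous_jumpDensity_right (x : ℝ) : Continuous (jumpDensity c x) :=
  ((continuous_jumpDensity hc).comp (by fun_prop : Continuous fun t : ℝ => (x, t))).congr
    fun _ => rfl

lemma continuous_jumpDensity_left (t : ℝ) : Continuous fun x => jumpDensity c x t :=
  ((continuous_jumpDensity hc).comp (by fun_prop : Continuous fun x : ℝ => (x, t))).congr
    fun _ => rfl

@[simp] lemma cumHazard_zero_right (x : ℝ) : cumHazard c x 0 = 0 := by
  simpa [clock_zero] using cumHazard_clock hc x 0

@[simp] lemma flow_zero_right (x : ℝ) : flow c x 0 = x := by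
  simp [flow, hc]

lemma cumHazard_add (x s t : ℝ) :
    cumHazard c x (s + t) = cumHazard c x s + cumHazard c (flow c x s) t := by
  apply (strictMono_clock hc x).injective
  rw [clock_add, clock_cumHazard hc, clock_cumHazard hc, ← flow, clock_cumHazard hc]

lemma flow_add (x s t : ℝ) : flow c x (s + t) = flow c (flow c x s) t := by
  rw [flow, cumHazard_add hc, Real.exp_add, ← mul_assoc, ← flow, ← flow]

lemma jumpDensity_add (x s t : ℝ) :
    jumpDensity c x (s + t) = Real.exp (-cumHazard c x s) * jumpDensity c (flow c x s) t := by
  rw [jumpDensity, flow_add hc, cumHazard_add hc, neg_add, Real.exp_add, jumpDensity, mul_div_assoc]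

lemma cumHazard_nonneg (x : ℝ) {t : ℝ} (ht : 0 ≤ t) : 0 ≤ cumHazard c x t := by
  rw [← not_lt, cumHazard_lt_iff hc, clock_zero]; exact not_lt.2 ht

lemma flow_sq_sub_sq (x t : ℝ) :
    flow c x t ^ 2 - x ^ 2 = 2 * (t - c * cumHazard c x t) := by
  have h2 : Real.exp (2 * cumHazard c x t) = Real.exp (cumHazard c x t) ^ 2 := by
    rw [← Real.exp_nat_mul]; norm_cast
  have h := clock_cumHazard hc x t
  rw [clock, h2] at h
  rw [flow, mul_pow]
  linarith

lemma abs_le_abs_flow (x : ℝ) {t : ℝ} (ht : 0 ≤ t) : |x| ≤ |flow c x t| := by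
  rw [flow, abs_mul, Real.abs_exp]
  exact le_mul_of_one_le_right (abs_nonneg _) (Real.one_le_exp (cumHazard_nonneg hc x ht))

lemma sq_le_flow_sq (x : ℝ) {t : ℝ} (ht : 0 ≤ t) : x ^ 2 ≤ flow c x t ^ 2 :=
  sq_le_sq.2 (abs_le_abs_flow hc x ht)

lemma cumHazard_le (x : ℝ) {t : ℝ} (ht : 0 ≤ t) : cumHazard c x t ≤ t / c := by
  have := flow_sq_sub_sq hc x t
  have := sq_le_flow_sq hc x ht
  rw [le_div_iff₀ hc]; linarith

lemma flow_sub_sq_le (x : ℝ) {t : ℝ} (ht : 0 ≤ t) : (flow c x t - x) ^ 2 ≤ 2 * t := by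
  have h1 := flow_sq_sub_sq hc x t
  have h2 := cumHazard_nonneg hc x ht
  have h3 : 0 ≤ x * (flow c x t - x) := by
    have : x * (flow c x t - x) = x ^ 2 * (Real.exp (cumHazard c x t) - 1) := by
      rw [flow]; ring
    rw [this]
    exact mul_nonneg (sq_nonneg _) (sub_nonneg.2 (Real.one_le_exp h2))
  have h4 : 0 ≤ c * cumHazard c x t := by positivity
  nlinarith

lemma one_sub_survival_le (x : ℝ) {t : ℝ} (ht : 0 ≤ t) :
    1 - Real.exp (-cumHazard c x t) ≤ t / c := by
  have := Real.add_one_le_exp (-cumHazard c x t)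
  have := cumHazard_le hc x ht
  linarith

lemma survival_le_one (x : ℝ) {t : ℝ} (ht : 0 ≤ t) : Real.exp (-cumHazard c x t) ≤ 1 :=
  Real.exp_le_one_iff.2 (neg_nonpos.2 (cumHazard_nonneg hc x ht))

lemma jumpDensity_pos (x t : ℝ) : 0 < jumpDensity c x t := by
  unfold jumpDensity; positivity

lemma jumpDensity_le (x : ℝ) {t : ℝ} (ht : 0 ≤ t) : jumpDensity c x t ≤ 1 / (c + x ^ 2) := by
  have := sq_le_flow_sq hc x ht
  exact div_le_div₀ zero_le_one (survival_le_one hc x ht) (by positivity) (by linarith)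

lemma one_div_add_sq_le (x : ℝ) : 1 / (c + x ^ 2) ≤ 1 / c :=
  one_div_le_one_div_of_le hc (by nlinarith [sq_nonneg x])

lemma abs_jumpDensity_sub_le (x : ℝ) {t : ℝ} (ht : 0 ≤ t) :
    |jumpDensity c x t - 1 / (c + x ^ 2)| ≤ 3 * t / c ^ 2 := by
  have h0 := sq_le_flow_sq hc x ht
  have h1 := jumpDensity_le hc x ht
  have h2 := one_sub_survival_le hc x ht
  have h3 := flow_sq_sub_sq hc x t
  have h5 := mul_nonneg hc.le (cumHazard_nonneg hc x ht)
  rw [abs_sub_comm, abs_of_nonneg (by linarith)]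
  have e : 1 / (c + x ^ 2) - jumpDensity c x t
      = (1 - Real.exp (-cumHazard c x t)) * (1 / (c + flow c x t ^ 2))
        + (flow c x t ^ 2 - x ^ 2) * (1 / ((c + x ^ 2) * (c + flow c x t ^ 2))) := by
    have a1 : c + x ^ 2 ≠ 0 := by positivity
    have a2 : c + flow c x t ^ 2 ≠ 0 := by positivity
    unfold jumpDensity
    field_simp
    ring
  have h4 : 1 / ((c + x ^ 2) * (c + flow c x t ^ 2)) ≤ 1 / (c * c) := by
    apply one_div_le_one_div_of_le (by positivity)
    apply mul_le_mul _ _ hc.le (by positivity) <;> nlinarith [sq_nonneg x, sq_nonneg (flow c x t)]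
  calc _ = _ := e
    _ ≤ t / c * (1 / c) + 2 * t * (1 / (c * c)) := by
      apply add_le_add
      · exact mul_le_mul h2 (one_div_add_sq_le hc _) (by positivity) (by positivity)
      · exact mul_le_mul (by linarith) h4 (by positivity) (by positivity)
    _ = _ := by field_simp; ring

lemma hasDerivAt_cumHazard (x t : ℝ) :
    HasDerivAt (cumHazard c x) (1 / (c + flow c x t ^ 2)) t := by
  rw [one_div]
  refine HasDerivAt.of_local_left_inverse (f := clock c x)
    (continuous_cumHazard_right hc x).continuousAt (hasDerivAt_clock c x _)
    (by positivity) (Eventually.of_forall (clock_cumHazard hc x))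

lemma hasDerivAt_survival (x t : ℝ) :
    HasDerivAt (fun t => Real.exp (-cumHazard c x t)) (-jumpDensity c x t) t := by
  exact (hasDerivAt_cumHazard hc x t).neg.exp.congr_deriv (by
    simp only [jumpDensity, Pi.neg_apply]; ring)

lemma hasDerivAt_flow (x t : ℝ) :
    HasDerivAt (flow c x) (flow c x t / (c + flow c x t ^ 2)) t := by
  exact ((hasDerivAt_cumHazard hc x t).exp.const_mul x).congr_deriv (by
    rw [← mul_assoc, ← flow]; ring)

lemma cumHazard_tendsto_atTop (x : ℝ) : Tendsto (cumHazard c x) atTop atTop := by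
  refine tendsto_atTop.2 fun b => ?_
  filter_upwards [eventually_gt_atTop (clock c x b)] with t ht
  exact ((lt_cumHazard_iff hc).2 ht).le

lemma integral_jumpDensity (x s t : ℝ) :
    ∫ v in s..t, jumpDensity c x v
      = Real.exp (-cumHazard c x s) - Real.exp (-cumHazard c x t) := by
  have := intervalIntegral.integral_eq_sub_of_hasDerivAt (a := s) (b := t)
    (fun v _ => (hasDerivAt_survival hc x v).neg)
    (by simpa using (continuous_jumpDensity_right hc x).intervalIntegrable s t)
  simp only [neg_neg] at this
  rw [this]; simp only [Pi.neg_apply]; ring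

lemma lintegral_jumpDensity (x : ℝ) {s t : ℝ} (hst : s ≤ t) :
    ∫⁻ v in Set.Ioc s t, ENNReal.ofReal (jumpDensity c x v)
      = ENNReal.ofReal (Real.exp (-cumHazard c x s) - Real.exp (-cumHazard c x t)) := by
  rw [← integral_jumpDensity hc, intervalIntegral.integral_of_le hst,
    ofReal_integral_eq_lintegral_ofReal]
  · exact ((continuous_jumpDensity_right hc x).continuousOn.integrableOn_Icc).mono_set
      Set.Ioc_subset_Icc_self
  · exact ae_of_all _ fun v => (jumpDensity_pos hc x v).le

omit hc in
lemma cumHazard_congr_sq {x y : ℝ} (h : x ^ 2 = y ^ 2) (t : ℝ) :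
    cumHazard c x t = cumHazard c y t := by
  have : clock c x = clock c y := by funext h'; simp [clock, h]
  rw [cumHazard, this, cumHazard]

end

/-! ### The transition kernels -/

section

variable {c : ℝ} (hc : 0 < c) (M : Kernel ℝ ℝ)

/-- The kernel of a process that follows the flow up to its first jump, whose density is
`jumpDensity c x`, and has the law `M w` at time `w` after that jump. -/
def transitionKernel (t : ℝ) : Kernel ℝ ℝ :=
  Kernel.withDensity (Kernel.deterministic (fun x => flow c x t)
      (continuous_flow_left hc t).measurable)
    (fun x _ => ENNReal.ofReal (Real.exp (-cumHazard c x t)))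
  + (M.comap (fun v => t - v) (by fun_prop)) ∘ₖ
    Kernel.withDensity (Kernel.const ℝ ((volume : Measure ℝ).restrict (Set.Ioc 0 t)))
      (fun x v => ENNReal.ofReal (jumpDensity c x v))

lemma transitionKernel_apply (t x : ℝ) :
    transitionKernel hc M t x
      = ENNReal.ofReal (Real.exp (-cumHazard c x t)) • Measure.dirac (flow c x t)
        + (M.comap (fun v => t - v) (by fun_prop)) ∘ₘ
          (volume.restrict (Set.Ioc 0 t)).withDensity
            (fun v => ENNReal.ofReal (jumpDensity c x v)) := by
  have h1 : Measurable (Function.uncurry fun x (_ : ℝ) =>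
      ENNReal.ofReal (Real.exp (-cumHazard c x t))) :=
    ((((continuous_cumHazard_left hc t).measurable.comp measurable_fst).neg).exp).ennreal_ofReal
  have h2 : Measurable (Function.uncurry fun x v => ENNReal.ofReal (jumpDensity c x v)) :=
    (continuous_jumpDensity hc).measurable.ennreal_ofReal
  rw [transitionKernel, add_apply, Kernel.comp_apply, Kernel.withDensity_apply _ h1,
    Kernel.withDensity_apply _ h2, Kernel.deterministic_apply, Kernel.const_apply,
    withDensity_const]

include hc in
lemma measurable_ofReal_jumpDensity (x : ℝ) :
    Measurable fun v => ENNReal.ofReal (jumpDensity c x v) :=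
  (continuous_jumpDensity_right hc x).measurable.ennreal_ofReal

lemma lintegral_transitionKernel (t x : ℝ) {f : ℝ → ENNReal} (hf : Measurable f) :
    ∫⁻ y, f y ∂(transitionKernel hc M t x)
      = ENNReal.ofReal (Real.exp (-cumHazard c x t)) * f (flow c x t)
        + ∫⁻ v in Set.Ioc 0 t, ENNReal.ofReal (jumpDensity c x v) * ∫⁻ y, f y ∂(M (t - v)) := by
  have h3 : Measurable fun v => ∫⁻ y, f y ∂(M (t - v)) :=
    hf.lintegral_kernel.comp (by fun_prop : Measurable fun v => t - v)
  rw [transitionKernel_apply, lintegral_add_measure, lintegral_smul_measure, lintegral_dirac' _ hf,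
    Measure.lintegral_bind (by fun_prop) hf.aemeasurable,
    lintegral_withDensity_eq_lintegral_mul _ (measurable_ofReal_jumpDensity hc x)
      (by simpa [Kernel.comap_apply] using h3)]
  simp [Kernel.comap_apply]

lemma transitionKernel_apply_apply (t x : ℝ) {B : Set ℝ} (hB : MeasurableSet B) :
    transitionKernel hc M t x B
      = ENNReal.ofReal (Real.exp (-cumHazard c x t)) * B.indicator 1 (flow c x t)
        + ∫⁻ v in Set.Ioc 0 t, ENNReal.ofReal (jumpDensity c x v) * M (t - v) B := by
  rw [← lintegral_indicator_one hB, lintegral_transitionKernel hc M t x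
    (measurable_one.indicator hB)]
  simp_rw [lintegral_indicator_one hB]

lemma isMarkovKernel_transitionKernel [IsMarkovKernel M] {t : ℝ} (ht : 0 ≤ t) :
    IsMarkovKernel (transitionKernel hc M t) := by
  refine ⟨fun x => ⟨?_⟩⟩
  rw [transitionKernel_apply_apply hc M t x MeasurableSet.univ]
  simp only [Set.indicator_univ, Pi.one_apply, mul_one, measure_univ]
  rw [lintegral_jumpDensity hc x ht, ← ENNReal.ofReal_add (Real.exp_nonneg _)]
  · simp [hc]
  · simp [hc, cumHazard_nonneg hc x ht]

lemma transitionKernel_zero : transitionKernel hc M 0 = Kernel.id := by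
  ext x : 1
  rw [transitionKernel_apply]
  simp [hc, Kernel.id_apply]

lemma setLIntegral_Ioc_comp_add (f : ℝ → ENNReal) (a s t : ℝ) :
    ∫⁻ v in Set.Ioc s t, f (a + v) = ∫⁻ v in Set.Ioc (a + s) (a + t), f v := by
  have h := (measurePreserving_add_left (volume : Measure ℝ) a).setLIntegral_comp_preimage_emb
    (measurableEmbedding_addLeft a) f (Set.Ioc (a + s) (a + t))
  rw [← h]; simp

/-- Running the flow for time `a` without a jump, and then the transition kernel. -/
lemma survival_mul_transitionKernel (x a t : ℝ) {B : Set ℝ} (hB : MeasurableSet B) :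
    ENNReal.ofReal (Real.exp (-cumHazard c x a)) * transitionKernel hc M t (flow c x a) B
      = ENNReal.ofReal (Real.exp (-cumHazard c x (a + t))) * B.indicator 1 (flow c x (a + t))
        + ∫⁻ v in Set.Ioc a (a + t), ENNReal.ofReal (jumpDensity c x v) * M (a + t - v) B := by
  have h3 : Measurable fun v => M (t - v) B :=
    (Kernel.measurable_coe M hB).comp (by fun_prop : Measurable fun v => t - v)
  rw [transitionKernel_apply_apply hc M t _ hB, mul_add, ← mul_assoc,
    ← ENNReal.ofReal_mul (Real.exp_nonneg _), ← Real.exp_add, ← neg_add, ← cumHazard_add hc,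
    ← flow_add hc]
  congr 1
  have h := setLIntegral_Ioc_comp_add
    (fun v => ENNReal.ofReal (jumpDensity c x v) * M (a + t - v) B) a 0 t
  rw [add_zero] at h
  rw [← h]
  refine (lintegral_const_mul _ ((measurable_ofReal_jumpDensity hc _).mul h3)).symm.trans
    (lintegral_congr fun v => ?_)
  simp only [Pi.mul_apply]
  rw [jumpDensity_add hc, ENNReal.ofReal_mul (Real.exp_nonneg _), mul_assoc]
  congr 4; ring

lemma transitionKernel_add
    (hM : ∀ s t : ℝ, 0 ≤ s → 0 ≤ t → ∀ B, MeasurableSet B →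
      ∫⁻ y, transitionKernel hc M t y B ∂(M s) = M (s + t) B)
    {s t : ℝ} (hs : 0 ≤ s) (ht : 0 ≤ t) :
    transitionKernel hc M (s + t) = transitionKernel hc M t ∘ₖ transitionKernel hc M s := by
  ext x B hB
  rw [Kernel.comp_apply' _ _ _ hB,
    lintegral_transitionKernel hc M s x (Kernel.measurable_coe _ hB),
    survival_mul_transitionKernel hc M x s t hB, transitionKernel_apply_apply hc M _ x hB,
    ← Set.Ioc_union_Ioc_eq_Ioc hs (by linarith : s ≤ s + t),
    lintegral_union measurableSet_Ioc (Set.Ioc_disjoint_Ioc_of_le le_rfl), add_assoc,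
    add_comm (∫⁻ v in Set.Ioc 0 s, _)]
  congr 2
  refine setLIntegral_congr_fun measurableSet_Ioc fun v hv => ?_
  rw [hM _ _ (by linarith [hv.2]) ht B hB]
  congr 3; ring

lemma integral_transitionKernel {t : ℝ} (ht : 0 ≤ t) (x : ℝ) {f : ℝ → ℝ}
    (hi : Integrable f (transitionKernel hc M t x)) :
    ∫ y, f y ∂(transitionKernel hc M t x)
      = Real.exp (-cumHazard c x t) * f (flow c x t)
        + ∫ v in 0..t, jumpDensity c x v * ∫ y, f y ∂(M (t - v)) := by
  rw [transitionKernel_apply] at hi ⊢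
  have h := hi.right_of_add_measure
  rw [integral_add_measure hi.left_of_add_measure h, integral_smul_measure, integral_dirac]
  rw [Measure.comp_eq_comp_const_apply] at h ⊢
  rw [Kernel.integral_comp h, Kernel.const_apply,
    integral_withDensity_eq_integral_toReal_smul (measurable_ofReal_jumpDensity hc x)
      (ae_of_all _ fun _ => ENNReal.ofReal_lt_top), intervalIntegral.integral_of_le ht,
    ENNReal.toReal_ofReal (Real.exp_nonneg _), smul_eq_mul]
  simp only [ENNReal.toReal_ofReal (jumpDensity_pos hc x _).le, smul_eq_mul, Kernel.comap_apply]

end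

/-- The properties of the law `M w` of a process at time `w` after a jump to `±√c` with
fair signs that do not involve its dependence structure. -/
structure IsFreshLaw (c : ℝ) (M : Kernel ℝ ℝ) : Prop where
  markov : IsMarkovKernel M
  locally_bounded : ∀ T : ℝ, ∃ R : ℝ, ∀ w ∈ Set.Icc 0 T, ∀ᵐ y ∂(M w), |y| ≤ R
  tendsto_zero : ∀ g : ℝ → ℝ, Continuous g →
    Tendsto (fun w => ∫ y, g y ∂(M w)) (𝓝[≥] 0) (𝓝 (1 / 2 * (g (-√c) + g √c)))

section

variable {c : ℝ} (hc : 0 < c) {M : Kernel ℝ ℝ} (hM : IsFreshLaw c M)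
include hM

lemma exists_bound_fresh {g : ℝ → ℝ} (hg : Continuous g) (T : ℝ) :
    ∃ C : ℝ, 0 ≤ C ∧ ∀ w ∈ Set.Icc 0 T, |∫ y, g y ∂(M w)| ≤ C := by
  have := hM.markov
  obtain ⟨R, hR⟩ := hM.locally_bounded T
  obtain ⟨C, hC⟩ := (isCompact_Icc (a := -R) (b := R)).exists_bound_of_continuousOn hg.continuousOn
  refine ⟨max C 0, le_max_right _ _, fun w hw => ?_⟩
  have := norm_integral_le_of_norm_le_const (μ := M w) (f := g) (C := max C 0) (by
    filter_upwards [hR w hw] with y hy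
    exact (hC y (abs_le.1 hy)).trans (le_max_left _ _))
  simpa using this

lemma ae_bounded_transitionKernel {t : ℝ} (x : ℝ) :
    ∃ R : ℝ, ∀ᵐ y ∂(transitionKernel hc M t x), |y| ≤ R := by
  obtain ⟨R, hR⟩ := hM.locally_bounded t
  refine ⟨max R |flow c x t|, ?_⟩
  have hB : MeasurableSet {y : ℝ | |y| ≤ max R |flow c x t|}ᶜ :=
    (measurableSet_le (by fun_prop) (by fun_prop)).compl
  rw [ae_iff, ← Set.compl_ofPred, transitionKernel_apply_apply hc M t x hB]
  have h2 : ∀ v ∈ Set.Ioc 0 t, ENNReal.ofReal (jumpDensity c x v) *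
      M (t - v) {y : ℝ | |y| ≤ max R |flow c x t|}ᶜ = 0 := by
    intro v hv
    have h3 : ∀ᵐ y ∂(M (t - v)), |y| ≤ max R |flow c x t| := by
      filter_upwards [hR (t - v) ⟨by linarith [hv.2], by linarith [hv.1]⟩] with y hy
      exact hy.trans (le_max_left _ _)
    rw [ae_iff, ← Set.compl_ofPred] at h3
    rw [h3, mul_zero]
  rw [setLIntegral_congr_fun measurableSet_Ioc h2]
  simp

lemma integrable_transitionKernel {g : ℝ → ℝ} (hg : Continuous g) {t : ℝ} (ht : 0 ≤ t) (x : ℝ) :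
    Integrable g (transitionKernel hc M t x) := by
  have := hM.markov
  have := isMarkovKernel_transitionKernel hc M ht
  obtain ⟨R, hR⟩ := ae_bounded_transitionKernel hc hM (t := t) x
  obtain ⟨C, hC⟩ := (isCompact_Icc (a := -R) (b := R)).exists_bound_of_continuousOn hg.continuousOn
  refine Integrable.of_bound hg.aestronglyMeasurable C ?_
  filter_upwards [hR] with y hy
  exact hC y (abs_le.1 hy)

lemma measurable_fresh_integral {g : ℝ → ℝ} (hg : Continuous g) :
    Measurable fun w => ∫ y, g y ∂(M w) := by
  have := hM.markov
  exact (hg.stronglyMeasurable.integral_kernel).measurable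

include hc in
/-- The contribution of the jumps, to first order in `t`, uniformly in the starting point. -/
lemma tendstoUniformly_jump_part {g : ℝ → ℝ} (hg : Continuous g) :
    TendstoUniformly
      (fun (t : ℝ≥0) x => (∫ v in 0..(t : ℝ), jumpDensity c x v * ∫ y, g y ∂(M (t - v))) / (t : ℝ))
      (fun x => 1 / 2 * (g (-√c) + g √c) / (c + x ^ 2)) (𝓝[>] 0) := by
  obtain ⟨C, hC0, hC⟩ := exists_bound_fresh hM hg 1
  have hlim := hM.tendsto_zero g hg
  set m : ℝ → ℝ := fun w => ∫ y, g y ∂(M w)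
  set b := 1 / 2 * (g (-√c) + g √c)
  have hm : Measurable m := measurable_fresh_integral hM hg
  rw [Metric.tendstoUniformly_iff]
  intro e he
  have h1 : ∀ᶠ w in 𝓝[≥] (0 : ℝ), |m w - b| < e * c / 4 := by
    have := (Metric.tendsto_nhds.1 hlim) (e * c / 4) (by positivity)
    simpa [Real.dist_eq] using this
  obtain ⟨d, hd0, hd⟩ := (mem_nhdsGE_iff_exists_Ico_subset).1 h1
  simp only [Set.mem_Ioi] at hd0
  have h2 : ∀ᶠ t : ℝ≥0 in 𝓝[>] 0, (t : ℝ) < min (min d 1) (e * c ^ 2 / (12 * (C + 1))) := by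
    have : Tendsto (fun t : ℝ≥0 => (t : ℝ)) (𝓝[>] 0) (𝓝 0) :=
      (NNReal.continuous_coe.tendsto' 0 0 rfl).mono_left nhdsWithin_le_nhds
    exact this.eventually_lt_const (by positivity)
  filter_upwards [h2, self_mem_nhdsWithin] with t ht ht0 x
  have ht0 : (0 : ℝ) < t := by exact_mod_cast ht0
  simp only [lt_min_iff] at ht
  obtain ⟨⟨htd, ht1⟩, htC⟩ := ht
  have hint : IntervalIntegrable (fun v => jumpDensity c x v * m (t - v)) volume 0 t := by
    rw [intervalIntegrable_iff_integrableOn_Ioc_of_le ht0.le]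
    refine Measure.integrableOn_of_bounded (M := 1 / c * C) (by simp) ?_ ?_
    · exact ((continuous_jumpDensity_right hc x).measurable.mul
        (hm.comp (measurable_const.sub measurable_id))).aestronglyMeasurable
    · filter_upwards [ae_restrict_mem measurableSet_Ioc] with v hv
      rw [Real.norm_eq_abs, abs_mul, abs_of_pos (jumpDensity_pos hc x v)]
      refine mul_le_mul ((jumpDensity_le hc x hv.1.le).trans (one_div_add_sq_le hc x)) ?_
        (abs_nonneg _) (by positivity)
      exact hC _ ⟨by linarith [hv.2], by linarith [hv.1]⟩
  have key : ∀ v ∈ Set.uIoc 0 (t : ℝ),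
      ‖jumpDensity c x v * m (t - v) - b / (c + x ^ 2)‖ ≤ e / 2 := by
    intro v hv
    rw [Set.uIoc_of_le ht0.le] at hv
    have a1 := abs_jumpDensity_sub_le hc x hv.1.le
    have a2 := hC (t - v) ⟨by linarith [hv.2], by linarith [hv.1]⟩
    have a3 : |m (t - v) - b| < e * c / 4 := hd ⟨by linarith [hv.2], by linarith [hv.1]⟩
    have a4 := one_div_add_sq_le hc x
    have a5 : (0 : ℝ) ≤ 1 / (c + x ^ 2) := by positivity
    have e1 : jumpDensity c x v * m (t - v) - b / (c + x ^ 2)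
        = (jumpDensity c x v - 1 / (c + x ^ 2)) * m (t - v)
          + 1 / (c + x ^ 2) * (m (t - v) - b) := by ring
    rw [e1, Real.norm_eq_abs]
    refine (abs_add_le _ _).trans ?_
    rw [abs_mul, abs_mul, abs_of_nonneg a5]
    have b1 : |jumpDensity c x v - 1 / (c + x ^ 2)| * |m (t - v)|
        ≤ (3 * t / c ^ 2) * (C + 1) := by
      refine mul_le_mul (a1.trans ?_) (by linarith [show |m (t - v)| ≤ C from a2])
        (abs_nonneg _) (by positivity)
      have := hv.2
      gcongr
    have b2 : 1 / (c + x ^ 2) * |m (t - v) - b| ≤ 1 / c * (e * c / 4) :=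
      mul_le_mul a4 a3.le (abs_nonneg _) (by positivity)
    have b3 : (3 * t / c ^ 2) * (C + 1) ≤ e / 4 := by
      rw [lt_div_iff₀ (by positivity)] at htC
      rw [div_mul_eq_mul_div, div_le_iff₀ (by positivity)]
      linarith
    have b4 : 1 / c * (e * c / 4) = e / 4 := by field_simp
    linarith
  have := intervalIntegral.norm_integral_le_of_norm_le_const key
  rw [intervalIntegral.integral_sub hint (by simp), intervalIntegral.integral_const,
    sub_zero, abs_of_pos ht0, Real.norm_eq_abs, smul_eq_mul] at this
  rw [dist_comm, Real.dist_eq, div_sub' ht0.ne', abs_div, abs_of_pos ht0, div_lt_iff₀ ht0]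
  calc _ ≤ e / 2 * t := this
    _ < e * t := by gcongr; linarith

end

/-! ### The Feller property and the generator -/

lemma tendsto_nhdsGT_zero_nnreal {β : Type*} {f : ℝ → β} {l : Filter β}
    (h : Tendsto f (𝓝[>] 0) l) : Tendsto (fun t : ℝ≥0 => f t) (𝓝[>] 0) l := by
  refine h.comp (tendsto_nhdsWithin_iff.2 ⟨?_, ?_⟩)
  · exact (NNReal.continuous_coe.tendsto' 0 0 rfl).mono_left nhdsWithin_le_nhds
  · filter_upwards [self_mem_nhdsWithin] with t ht
    exact_mod_cast ht

lemma tendsto_toNNReal_sub (s : ℝ) :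
    Tendsto (fun u : ℝ => (u - s).toNNReal) (𝓝[>] s) (𝓝[>] 0) := by
  refine tendsto_nhdsWithin_iff.2 ⟨?_, ?_⟩
  · have : Continuous fun u : ℝ => (u - s).toNNReal := by fun_prop
    exact (this.tendsto' s 0 (by simp)).mono_left nhdsWithin_le_nhds
  · filter_upwards [self_mem_nhdsWithin] with t ht
    simpa using ht

lemma eventually_nhdsGT_zero_nnreal {p : ℝ → Prop} (h : ∀ᶠ t : ℝ≥0 in 𝓝[>] 0, p t) :
    ∃ d > 0, ∀ t : ℝ, 0 < t → t < d → p t := by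
  have h1 : ∀ᶠ u : ℝ in 𝓝[>] 0, p ((u - 0).toNNReal : ℝ≥0) :=
    (tendsto_toNNReal_sub 0).eventually h
  obtain ⟨d, hd, hsub⟩ := mem_nhdsGT_iff_exists_Ioo_subset.1 h1
  refine ⟨d, hd, fun t ht htd => ?_⟩
  have := hsub ⟨ht, htd⟩
  simpa [ht.le] using this

section

variable {c : ℝ} (hc : 0 < c)
include hc

omit hc in
lemma tendsto_one_div_add_sq (c : ℝ) : Tendsto (fun x : ℝ => 1 / (c + x ^ 2)) (cocompact ℝ) (𝓝 0) := by
  have h : Tendsto (fun x : ℝ => c + ‖x‖ ^ 2) (cocompact ℝ) atTop :=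
    tendsto_atTop_add_const_left _ _
      ((tendsto_pow_atTop two_ne_zero).comp (tendsto_norm_cocompact_atTop))
  exact h.inv_tendsto_atTop.congr fun x => by simp

/-- The jump rate, as a function vanishing at infinity. -/
def jumpRate : C₀(ℝ, ℝ) where
  toFun x := 1 / (c + x ^ 2)
  continuous_toFun := by
    refine Continuous.div (by fun_prop) (by fun_prop) fun x => ?_
    positivity
  zero_at_infty' := tendsto_one_div_add_sq c

lemma jumpRate_apply (x : ℝ) : jumpRate hc x = 1 / (c + x ^ 2) := rfl

lemma tendsto_flow_cocompact {t : ℝ} (ht : 0 ≤ t) :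
    Tendsto (fun x => flow c x t) (cocompact ℝ) (cocompact ℝ) := by
  nth_rw 2 [← Metric.cobounded_eq_cocompact]
  rw [← comap_norm_atTop]
  refine tendsto_comap_iff.2 (tendsto_atTop_mono (fun x => ?_) (tendsto_norm_cocompact_atTop))
  exact abs_le_abs_flow hc x ht

omit hc in
lemma exists_bound_zeroAtInfty (f : C₀(ℝ, ℝ)) : ∃ C : ℝ, 0 < C ∧ ∀ x, |f x| ≤ C := by
  exact ⟨max ‖f.toBCF‖ 1, by positivity, fun x =>
    (f.toBCF.norm_coe_le_norm x).trans (le_max_left _ _)⟩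

/-- Strong continuity of the flow killed at the first jump. -/
lemma tendstoUniformly_survival_mul (f : C₀(ℝ, ℝ)) :
    TendstoUniformly (fun (t : ℝ≥0) x => Real.exp (-cumHazard c x t) * f (flow c x t)) f
      (𝓝[>] 0) := by
  obtain ⟨C, hC0, hC⟩ := exists_bound_zeroAtInfty f
  rw [Metric.tendstoUniformly_iff]
  intro e he
  obtain ⟨d, hd0, hd⟩ := Metric.uniformContinuous_iff.1 (ZeroAtInftyContinuousMap.uniformContinuous f)
    (e / 2) (by positivity)
  have h2 : ∀ᶠ t : ℝ≥0 in 𝓝[>] 0, (t : ℝ) < min (d ^ 2 / 2) (e * c / (2 * C)) := by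
    have : Tendsto (fun t : ℝ≥0 => (t : ℝ)) (𝓝[>] 0) (𝓝 0) :=
      (NNReal.continuous_coe.tendsto' 0 0 rfl).mono_left nhdsWithin_le_nhds
    exact this.eventually_lt_const (by positivity)
  filter_upwards [h2] with t ht x
  obtain ⟨ht1, ht2⟩ := lt_min_iff.1 ht
  have a1 : |f (flow c x t) - f x| < e / 2 := by
    apply hd
    rw [Real.dist_eq]
    apply abs_lt_of_sq_lt_sq _ hd0.le
    linarith [flow_sub_sq_le hc x t.coe_nonneg]
  have a2 := one_sub_survival_le hc x t.coe_nonneg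
  have a3 := survival_le_one hc x t.coe_nonneg
  rw [dist_comm, Real.dist_eq]
  have e1 : Real.exp (-cumHazard c x t) * f (flow c x t) - f x
      = (f (flow c x t) - f x) - (1 - Real.exp (-cumHazard c x t)) * f (flow c x t) := by ring
  have a4 : |(1 - Real.exp (-cumHazard c x t)) * f (flow c x t)| ≤ e / 2 := by
    rw [abs_mul, abs_of_nonneg (by simpa using a3)]
    calc _ ≤ t / c * C := mul_le_mul a2 (hC _) (abs_nonneg _) (by positivity)
      _ ≤ e / 2 := by
        rw [lt_div_iff₀ (by positivity)] at ht2
        rw [div_mul_eq_mul_div, div_le_iff₀ hc]; linarith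
  rw [e1]
  calc _ ≤ _ := abs_sub _ _
    _ < e := by linarith

omit hc in
/-- The generator of the flow killed at the first jump. -/
def killedGen (c : ℝ) (g : ℝ → ℝ) (x : ℝ) : ℝ := (x * deriv g x - g x) / (c + x ^ 2)

lemma hasDerivAt_survival_mul {g : ℝ → ℝ} {x : ℝ} (s : ℝ)
    (hg : x ≠ 0 → DifferentiableAt ℝ g (flow c x s)) :
    HasDerivAt (fun t => Real.exp (-cumHazard c x t) * g (flow c x t))
      (Real.exp (-cumHazard c x s) * killedGen c g (flow c x s)) s := by
  have h1 := hasDerivAt_survival hc x s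
  rcases eq_or_ne x 0 with rfl | hx
  · have h0 : ∀ t, flow c 0 t = 0 := fun t => by simp [flow]
    simp only [h0] at hg ⊢
    refine (h1.mul_const (g 0)).congr_deriv ?_
    simp only [jumpDensity, killedGen, h0]
    ring
  · refine (h1.mul ((hg hx).hasDerivAt.comp s (hasDerivAt_flow hc x s))).congr_deriv ?_
    simp only [jumpDensity, killedGen, Function.comp_apply]
    ring

lemma tendsto_killed_quotient {g : ℝ → ℝ} {x : ℝ} (hg : x ≠ 0 → DifferentiableAt ℝ g x) :
    Tendsto (fun t : ℝ≥0 => (Real.exp (-cumHazard c x t) * g (flow c x t) - g x) / (t : ℝ))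
      (𝓝[>] 0) (𝓝 (killedGen c g x)) := by
  have h := hasDerivAt_survival_mul hc (g := g) (x := x) 0 (by simpa [hc] using hg)
  have h2 := h.tendsto_slope_zero_right
  simp only [hc, flow_zero_right, cumHazard_zero_right, zero_add, neg_zero, Real.exp_zero,
    one_mul, smul_eq_mul] at h2
  refine (tendsto_nhdsGT_zero_nnreal h2).congr fun t => ?_
  rw [div_eq_inv_mul]

/-- The difference quotients at `0` give the right derivative along the whole orbit. -/
lemma hasDerivWithinAt_survival_mul {g k : ℝ → ℝ}
    (h : ∀ x, Tendsto (fun t : ℝ≥0 =>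
      (Real.exp (-cumHazard c x t) * g (flow c x t) - g x) / (t : ℝ)) (𝓝[>] 0) (𝓝 (k x)))
    (x s : ℝ) :
    HasDerivWithinAt (fun t => Real.exp (-cumHazard c x t) * g (flow c x t))
      (Real.exp (-cumHazard c x s) * k (flow c x s)) (Set.Ici s) s := by
  rw [hasDerivWithinAt_iff_tendsto_slope, Set.Ici_sdiff_left]
  refine (((h (flow c x s)).comp (tendsto_toNNReal_sub s)).const_mul _).congr' ?_
  filter_upwards [self_mem_nhdsWithin] with u hu
  have hu' : s < u := hu
  have e : ((u - s).toNNReal : ℝ) = u - s := Real.coe_toNNReal _ (by linarith)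
  have e1 : cumHazard c x u = cumHazard c x s + cumHazard c (flow c x s) (u - s) := by
    rw [← cumHazard_add hc]; congr 1; ring
  have e2 : flow c x u = flow c (flow c x s) (u - s) := by
    rw [← flow_add hc]; congr 1; ring
  simp only [Function.comp, e, slope_def_field, e1, e2, neg_add, Real.exp_add]
  ring

lemma differentiableAt_of_tendsto_killed_quotient {g k : ℝ → ℝ} (hg : Continuous g)
    (hk : Continuous k)
    (h : ∀ x, Tendsto (fun t : ℝ≥0 =>
      (Real.exp (-cumHazard c x t) * g (flow c x t) - g x) / (t : ℝ)) (𝓝[>] 0) (𝓝 (k x)))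
    {y : ℝ} (hy : y ≠ 0) : DifferentiableAt ℝ g y := by
  set x := y / 2 with hx
  have hx0 : x ≠ 0 := by positivity
  have hyx : y / x = 2 := by rw [hx]; field_simp
  set f : ℝ → ℝ := fun t => Real.exp (-cumHazard c x t) * g (flow c x t) with hf
  set f' : ℝ → ℝ := fun t => Real.exp (-cumHazard c x t) * k (flow c x t) with hf'
  have c1 := continuous_cumHazard_right hc x
  have c2 := continuous_flow_right hc x
  have hfc : Continuous f := by fun_prop
  have hfc' : Continuous f' := by fun_prop
  have hI : ∀ s, HasDerivAt (fun t => f 0 + ∫ v in (0 : ℝ)..t, f' v) (f' s) s := fun s =>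
    (intervalIntegral.integral_hasDerivAt_right (hfc'.intervalIntegrable _ _)
      (hfc'.stronglyMeasurableAtFilter _ _) hfc'.continuousAt).const_add _
  have heq : ∀ t, 0 ≤ t → f t = f 0 + ∫ v in (0 : ℝ)..t, f' v := fun t ht =>
    eq_of_has_deriv_right_eq (f := f) (f' := f')
      (fun s _ => hasDerivWithinAt_survival_mul hc h x s) (fun s _ => (hI s).hasDerivWithinAt)
      hfc.continuousOn (fun s _ => (hI s).continuousAt.continuousWithinAt) (by simp) t ⟨ht, le_rfl⟩
  have hfd : ∀ s, 0 < s → DifferentiableAt ℝ f s := fun s hs =>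
    ((hI s).congr_of_eventuallyEq (by
      filter_upwards [lt_mem_nhds hs] with t ht using heq t ht.le)).differentiableAt
  have hτ : 0 < clock c x (Real.log (y / x)) := by
    rw [← clock_zero c x, (strictMono_clock hc x).lt_iff_lt, hyx]
    exact Real.log_pos (by norm_num)
  have hτd : DifferentiableAt ℝ (fun z => clock c x (Real.log (z / x))) y :=
    (hasDerivAt_clock c x _).differentiableAt.comp y
      ((differentiableAt_id.div_const x).log (by rw [hyx]; norm_num))
  have hcomp : DifferentiableAt ℝ (fun z => z / x * f (clock c x (Real.log (z / x)))) y :=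
    (differentiableAt_id.div_const x).mul (DifferentiableAt.comp (g := f) y (hfd _ hτ) hτd)
  refine hcomp.congr_of_eventuallyEq ?_
  have hpos : ∀ᶠ z in 𝓝 y, 0 < z / x :=
    (continuous_id.div_const x).continuousAt.eventually_const_lt (by simp [hyx])
  filter_upwards [hpos] with z hz
  simp only [hf, flow, cumHazard_clock hc, Real.exp_neg, Real.exp_log hz]
  rw [mul_div_cancel₀ z hx0, ← mul_assoc, mul_inv_cancel₀ hz.ne', one_mul]

/-- The generator of the killed flow on `C₀(ℝ)`. -/
lemma tendstoUniformly_killed_quotient_iff (g k : C₀(ℝ, ℝ)) :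
    TendstoUniformly (fun (t : ℝ≥0) x =>
      (Real.exp (-cumHazard c x t) * g (flow c x t) - g x) / (t : ℝ)) k (𝓝[>] 0) ↔
    (∀ x : ℝ, x ≠ 0 → DifferentiableAt ℝ g x) ∧ ∀ x, k x = killedGen c g x := by
  constructor
  · intro h
    have hp := fun x => h.tendsto_at x
    have hd : ∀ x : ℝ, x ≠ 0 → DifferentiableAt ℝ g x := fun x hx =>
      differentiableAt_of_tendsto_killed_quotient hc (map_continuous g) (map_continuous k) hp hx
    exact ⟨hd, fun x => tendsto_nhds_unique (hp x) (tendsto_killed_quotient hc (hd x))⟩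
  · rintro ⟨hd, hk⟩
    have hS := tendstoUniformly_survival_mul hc k
    rw [Metric.tendstoUniformly_iff] at hS ⊢
    intro e he
    obtain ⟨d, hd0, hS⟩ := eventually_nhdsGT_zero_nnreal
      (p := fun s => ∀ x, dist (k x) (Real.exp (-cumHazard c x s) * k (flow c x s)) < e / 2)
      (hS (e / 2) (by positivity))
    have h2 : ∀ᶠ t : ℝ≥0 in 𝓝[>] 0, (t : ℝ) < d := by
      have : Tendsto (fun t : ℝ≥0 => (t : ℝ)) (𝓝[>] 0) (𝓝 0) :=
        (NNReal.continuous_coe.tendsto' 0 0 rfl).mono_left nhdsWithin_le_nhds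
      exact this.eventually_lt_const hd0
    filter_upwards [h2, self_mem_nhdsWithin] with t ht ht0 x
    have ht0 : (0 : ℝ) < t := by exact_mod_cast ht0
    have hder : ∀ s : ℝ, HasDerivAt
        (fun u => Real.exp (-cumHazard c x u) * g (flow c x u) - u * k x)
        (Real.exp (-cumHazard c x s) * k (flow c x s) - 1 * k x) s := by
      intro s
      rw [hk (flow c x s)]
      refine (hasDerivAt_survival_mul hc s fun hx => hd _ ?_).sub
        ((hasDerivAt_id s).mul_const (k x))
      exact mul_ne_zero hx (Real.exp_pos _).ne'
    have := norm_image_sub_le_of_norm_deriv_le_segment' (a := 0) (b := (t : ℝ)) (C := e / 2)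
      (fun s _ => (hder s).hasDerivWithinAt) (fun s hs => by
        rcases hs.1.eq_or_lt with rfl | hs0
        · simp [hc]; positivity
        · have := hS s hs0 (hs.2.trans ht) x
          rw [dist_comm, Real.dist_eq] at this
          rw [one_mul]
          exact this.le) t ⟨ht0.le, le_rfl⟩
    simp only [hc, cumHazard_zero_right, flow_zero_right, neg_zero, Real.exp_zero, one_mul,
      zero_mul, sub_zero, Real.norm_eq_abs] at this
    rw [dist_comm, Real.dist_eq, div_sub' ht0.ne', abs_div, abs_of_pos ht0, div_lt_iff₀ ht0,
      sub_right_comm]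
    calc _ ≤ e / 2 * t := this
      _ < e * t := by gcongr; linarith

variable {M : Kernel ℝ ℝ} (hM : IsFreshLaw c M)
include hM

lemma transition_quotient_eq {g : ℝ → ℝ} (hg : Continuous g) (t : ℝ≥0) (x : ℝ) :
    ((∫ y, g y ∂(transitionKernel hc M t x)) - g x) / (t : ℝ)
      = (Real.exp (-cumHazard c x t) * g (flow c x t) - g x) / (t : ℝ)
        + (∫ v in 0..(t : ℝ), jumpDensity c x v * ∫ y, g y ∂(M (t - v))) / (t : ℝ) := by
  rw [integral_transitionKernel hc M t.coe_nonneg x (integrable_transitionKernel hc hM hg t.coe_nonneg x)]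
  ring

lemma inGeneratorGraph_transitionKernel_iff (g h : C₀(ℝ, ℝ)) :
    InGeneratorGraph (fun t : ℝ≥0 => transitionKernel hc M t) g h ↔
      (∀ x : ℝ, x ≠ 0 → DifferentiableAt ℝ g x) ∧
      ∀ x : ℝ, h x = (1 / 2 * (g (-√c) + g √c) - g x + x * deriv g x) / (c + x ^ 2) := by
  have hJ := tendstoUniformly_jump_part hc hM (map_continuous g)
  set b := 1 / 2 * (g (-√c) + g √c)
  have h1 := tendstoUniformly_killed_quotient_iff hc g (h - b • jumpRate hc)
  have h2 : (∀ x, (h - b • jumpRate hc) x = killedGen c g x) ↔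
      ∀ x : ℝ, h x = (b - g x + x * deriv g x) / (c + x ^ 2) := by
    refine forall_congr' fun x => ?_
    simp only [ZeroAtInftyContinuousMap.sub_apply, ZeroAtInftyContinuousMap.smul_apply,
      jumpRate_apply, killedGen, smul_eq_mul]
    rw [sub_eq_iff_eq_add]
    ring_nf
  rw [← h2, ← h1, InGeneratorGraph]
  simp only [transition_quotient_eq hc hM (map_continuous g)]
  constructor
  · intro hh
    have := hh.sub hJ
    convert this using 1
    · ext t x; simp
    · ext x; simp [jumpRate_apply, div_eq_mul_inv]
  · intro hh
    have := hh.add hJ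
    convert this using 1
    · ext t x; simp
    · ext x; simp [jumpRate_apply, div_eq_mul_inv]

lemma tendsto_transition_quotient {g : ℝ → ℝ} (hg : Differentiable ℝ g) (x : ℝ) :
    Tendsto (fun t : ℝ≥0 => ((∫ y, g y ∂(transitionKernel hc M t x)) - g x) / (t : ℝ)) (𝓝[>] 0)
      (𝓝 ((1 / 2 * (g (-√c) + g √c) - g x + x * deriv g x) / (c + x ^ 2))) := by
  simp only [transition_quotient_eq hc hM hg.continuous]
  convert (tendsto_killed_quotient hc fun _ => hg x).add
    ((tendstoUniformly_jump_part hc hM hg.continuous).tendsto_at x) using 2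
  rw [killedGen]
  ring

omit hM in
lemma norm_jump_integrand_le {g : ℝ → ℝ} {t C : ℝ}
    (hC : ∀ w ∈ Set.Icc 0 t, |∫ y, g y ∂(M w)| ≤ C) (x : ℝ) {v : ℝ} (hv : v ∈ Set.Ioc 0 t) :
    ‖jumpDensity c x v * ∫ y, g y ∂(M (t - v))‖ ≤ 1 / (c + x ^ 2) * C := by
  rw [Real.norm_eq_abs, abs_mul, abs_of_pos (jumpDensity_pos hc x v)]
  exact mul_le_mul (jumpDensity_le hc x hv.1.le)
    (hC _ ⟨by linarith [hv.2], by linarith [hv.1]⟩) (abs_nonneg _) (by positivity)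

omit hM in
lemma norm_jump_integral_le {g : ℝ → ℝ} {t C : ℝ} (ht : 0 ≤ t)
    (hC : ∀ w ∈ Set.Icc 0 t, |∫ y, g y ∂(M w)| ≤ C) (x : ℝ) :
    |∫ v in 0..t, jumpDensity c x v * ∫ y, g y ∂(M (t - v))| ≤ 1 / (c + x ^ 2) * C * t := by
  have := intervalIntegral.norm_integral_le_of_norm_le_const (a := 0) (b := t)
    (f := fun v => jumpDensity c x v * ∫ y, g y ∂(M (t - v))) (C := 1 / (c + x ^ 2) * C)
    (fun v hv => norm_jump_integrand_le hc hC x (by rwa [Set.uIoc_of_le ht] at hv))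
  rwa [sub_zero, abs_of_nonneg ht] at this

lemma isFeller_transitionKernel : IsFeller (fun t : ℝ≥0 => transitionKernel hc M t) where
  maps_zeroAtInfty t f := by
    have hf := map_continuous f
    have hf0 := zero_at_infty f
    obtain ⟨C, hC0, hC⟩ := exists_bound_fresh hM hf t
    have hint := fun x => integral_transitionKernel hc M t.coe_nonneg x
      (integrable_transitionKernel hc hM hf t.coe_nonneg x)
    have c1 := continuous_cumHazard_left hc t
    have c2 := continuous_flow_left hc t
    refine ⟨⟨⟨fun x => ∫ y, f y ∂(transitionKernel hc M t x), ?_⟩, ?_⟩, fun x => rfl⟩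
    · simp only [hint]
      refine Continuous.add ((Real.continuous_exp.comp c1.neg).mul (hf.comp c2)) ?_
      refine intervalIntegral.continuous_of_dominated_interval (bound := fun _ => 1 / c * C) ?_ ?_
        (by simp) ?_
      · intro x
        exact ((continuous_jumpDensity_right hc x).measurable.mul
          ((measurable_fresh_integral hM hf).comp
            (measurable_const.sub measurable_id))).aestronglyMeasurable
      · refine fun x => ae_of_all _ fun v hv => ?_
        rw [Set.uIoc_of_le t.coe_nonneg] at hv
        exact (norm_jump_integrand_le hc hC x hv).trans
          (mul_le_mul_of_nonneg_right (one_div_add_sq_le hc x) hC0)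
      · exact ae_of_all _ fun v _ => (continuous_jumpDensity_left hc v).mul continuous_const
    · change Tendsto (fun x => ∫ y, f y ∂(transitionKernel hc M t x)) _ _
      simp only [hint]
      refine Tendsto.mono_right (y := 𝓝 (0 + 0)) (Tendsto.add ?_ ?_) (by simp)
      · refine squeeze_zero_norm (fun x => ?_)
          ((hf0.comp (tendsto_flow_cocompact hc t.coe_nonneg)).norm.trans (by simp))
        rw [norm_mul, Real.norm_eq_abs, Real.abs_exp]
        exact mul_le_of_le_one_left (norm_nonneg _) (survival_le_one hc x t.coe_nonneg)
      · refine squeeze_zero_norm (fun x => norm_jump_integral_le hc t.coe_nonneg hC x) ?_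
        simpa using ((tendsto_one_div_add_sq c).mul_const C).mul_const (t : ℝ)
  strongly_continuous f := by
    have hf := map_continuous f
    obtain ⟨C, hC0, hC⟩ := exists_bound_fresh hM hf 1
    have h2 : TendstoUniformly
        (fun (t : ℝ≥0) x => ∫ v in 0..(t : ℝ), jumpDensity c x v * ∫ y, f y ∂(M (t - v)))
        0 (𝓝[>] 0) := by
      rw [Metric.tendstoUniformly_iff]
      intro e he
      have h2 : ∀ᶠ t : ℝ≥0 in 𝓝[>] 0, (t : ℝ) < min 1 (e * c / (C + 1)) := by
        have : Tendsto (fun t : ℝ≥0 => (t : ℝ)) (𝓝[>] 0) (𝓝 0) :=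
          (NNReal.continuous_coe.tendsto' 0 0 rfl).mono_left nhdsWithin_le_nhds
        exact this.eventually_lt_const (by positivity)
      filter_upwards [h2] with t ht x
      obtain ⟨ht1, ht2⟩ := lt_min_iff.1 ht
      rw [Pi.zero_apply, dist_zero_left]
      refine (norm_jump_integral_le hc t.coe_nonneg
        (fun w hw => hC w ⟨hw.1, hw.2.trans ht1.le⟩) x).trans_lt ?_
      have h3 : (t : ℝ) * (C + 1) < e * c := (lt_div_iff₀ (by positivity)).1 ht2
      calc 1 / (c + x ^ 2) * C * t ≤ 1 / c * C * t := by
            gcongr ?_ * _ * _; exact one_div_add_sq_le hc x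
        _ = C * t / c := by ring
        _ < e := by
          rw [div_lt_iff₀ hc]
          have : (0 : ℝ) ≤ t := t.coe_nonneg
          rcases this.eq_or_lt with h | h
          · rw [← h]; simp; positivity
          · linarith
    have h3 := (tendstoUniformly_survival_mul hc f).add h2
    rw [add_zero] at h3
    convert h3 using 3 with t x
    exact integral_transitionKernel hc M t.coe_nonneg x (integrable_transitionKernel hc hM hf t.coe_nonneg x)

end

/-! ### Renewal paths -/

/-- The `k`-th jump time of the path with waiting times `p (inl i)`. -/
def jumpTime (p : ℕ ⊕ ℕ → ℝ) (k : ℕ) : ℝ := ∑ i ∈ Finset.range k, p (Sum.inl i)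

/-- The number of jumps up to time `t`. -/
def jumpCount (p : ℕ ⊕ ℕ → ℝ) (t : ℝ) : ℕ := ⨆ k, if jumpTime p k ≤ t then k else 0

/-- The path with waiting times `p (inl i)` that starts and restarts, at each jump, from
`√c` times the sign `p (inr i)`, and follows the flow between the jumps. -/
def jumpPath (c t : ℝ) (p : ℕ ⊕ ℕ → ℝ) : ℝ :=
  p (Sum.inr (jumpCount p t)) * flow c √c (t - jumpTime p (jumpCount p t))

/-- The data after the first `m` jumps. -/
def shiftPath (m : ℕ) (p : ℕ ⊕ ℕ → ℝ) : ℕ ⊕ ℕ → ℝ :=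
  fun i => p (Sum.map (m + ·) (m + ·) i)

/-- The data up to the `k`-th jump, completed by waiting times `d`. -/
def pastPath (d : ℝ) (k : ℕ) (p : ℕ ⊕ ℕ → ℝ) : ℕ ⊕ ℕ → ℝ :=
  Sum.elim (fun i => if i < k then p (Sum.inl i) else d)
    (fun i => if i ≤ k then p (Sum.inr i) else 0)

/-- Positive waiting times that do not accumulate, and signs `±1`. -/
structure IsGoodPath (p : ℕ ⊕ ℕ → ℝ) : Prop where
  pos : ∀ i, 0 < p (Sum.inl i)
  unbounded : ∀ x, ∃ k, x < jumpTime p k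
  sign : ∀ i, p (Sum.inr i) = 1 ∨ p (Sum.inr i) = -1

lemma jumpTime_zero (p : ℕ ⊕ ℕ → ℝ) : jumpTime p 0 = 0 := by simp [jumpTime]

lemma jumpTime_succ (p : ℕ ⊕ ℕ → ℝ) (k : ℕ) :
    jumpTime p (k + 1) = jumpTime p k + p (Sum.inl k) := by
  simp [jumpTime, Finset.sum_range_succ]

lemma strictMono_jumpTime {p : ℕ ⊕ ℕ → ℝ} (hp : ∀ i, 0 < p (Sum.inl i)) :
    StrictMono (jumpTime p) :=
  strictMono_nat_of_lt_succ fun k => by rw [jumpTime_succ]; linarith [hp k]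

lemma jumpTime_nonneg {p : ℕ ⊕ ℕ → ℝ} (hp : ∀ i, 0 < p (Sum.inl i)) (k : ℕ) :
    0 ≤ jumpTime p k := by
  rw [← jumpTime_zero p]; exact (strictMono_jumpTime hp).monotone (Nat.zero_le k)

lemma jumpCount_eq {p : ℕ ⊕ ℕ → ℝ} (hp : ∀ i, 0 < p (Sum.inl i)) {k : ℕ} {t : ℝ}
    (h1 : jumpTime p k ≤ t) (h2 : t < jumpTime p (k + 1)) : jumpCount p t = k := by
  have hle : ∀ j, (if jumpTime p j ≤ t then j else 0) ≤ k := fun j => by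
    split_ifs with hj
    · by_contra! hkj
      exact absurd ((strictMono_jumpTime hp).monotone (Nat.succ_le_of_lt hkj)) (by
        rw [Nat.succ_eq_add_one]; linarith)
    · exact Nat.zero_le k
  refine le_antisymm (ciSup_le hle) ?_
  have := le_ciSup (f := fun j => if jumpTime p j ≤ t then j else 0)
    ⟨k, by rintro _ ⟨j, rfl⟩; exact hle j⟩ k
  simp only [h1, if_true] at this
  exact this

lemma IsGoodPath.exists_mem_Ico {p : ℕ ⊕ ℕ → ℝ} (hp : IsGoodPath p) {t : ℝ} (ht : 0 ≤ t) :
    ∃ k, jumpTime p k ≤ t ∧ t < jumpTime p (k + 1) := by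
  classical
  have hex := hp.unbounded t
  obtain ⟨k, hk⟩ : ∃ k, Nat.find hex = k + 1 := Nat.exists_eq_succ_of_ne_zero fun h => by
    have := Nat.find_spec hex
    rw [h, jumpTime_zero] at this
    linarith
  refine ⟨k, not_lt.1 (Nat.find_min hex (by omega)), hk ▸ Nat.find_spec hex⟩

lemma IsGoodPath.jumpCount_eq_iff {p : ℕ ⊕ ℕ → ℝ} (hp : IsGoodPath p) {t : ℝ} (ht : 0 ≤ t)
    (k : ℕ) : jumpCount p t = k ↔ jumpTime p k ≤ t ∧ t < jumpTime p (k + 1) := by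
  refine ⟨fun h => ?_, fun h => jumpCount_eq hp.pos h.1 h.2⟩
  obtain ⟨j, hj⟩ := hp.exists_mem_Ico ht
  rw [jumpCount_eq hp.pos hj.1 hj.2] at h
  rwa [← h]

lemma jumpPath_eq {p : ℕ ⊕ ℕ → ℝ} (hp : ∀ i, 0 < p (Sum.inl i)) (c : ℝ) {k : ℕ} {t : ℝ}
    (h1 : jumpTime p k ≤ t) (h2 : t < jumpTime p (k + 1)) :
    jumpPath c t p = p (Sum.inr k) * flow c √c (t - jumpTime p k) := by
  rw [jumpPath, jumpCount_eq hp h1 h2]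

lemma jumpTime_shiftPath (p : ℕ ⊕ ℕ → ℝ) (m j : ℕ) :
    jumpTime (shiftPath m p) j = jumpTime p (m + j) - jumpTime p m := by
  simp [jumpTime, shiftPath, Finset.sum_range_add]

lemma IsGoodPath.jumpPath_shiftPath {p : ℕ ⊕ ℕ → ℝ} (hp : IsGoodPath p) (c : ℝ) {m : ℕ} {t : ℝ}
    (ht : jumpTime p m ≤ t) :
    jumpPath c t p = jumpPath c (t - jumpTime p m) (shiftPath m p) := by
  obtain ⟨k, hk1, hk2⟩ := hp.exists_mem_Ico ((jumpTime_nonneg hp.pos m).trans ht)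
  have hmk : m ≤ k := by
    have := (strictMono_jumpTime hp.pos).lt_iff_lt.1 (ht.trans_lt hk2)
    omega
  obtain ⟨j, rfl⟩ := Nat.exists_eq_add_of_le hmk
  rw [jumpPath_eq hp.pos c hk1 hk2, jumpPath_eq (p := shiftPath m p) (k := j)
    (fun i => hp.pos (m + i)) c]
  · rw [jumpTime_shiftPath, sub_sub_sub_cancel_right]; rfl
  · rw [jumpTime_shiftPath]; linarith
  · rw [jumpTime_shiftPath, ← add_assoc]; linarith

lemma jumpTime_pastPath (d : ℝ) {j k : ℕ} (hjk : j ≤ k) (p : ℕ ⊕ ℕ → ℝ) :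
    jumpTime (pastPath d k p) j = jumpTime p j := by
  refine Finset.sum_congr rfl fun i hi => ?_
  simp [pastPath, (Finset.mem_range.1 hi).trans_le hjk]

lemma IsGoodPath.jumpPath_pastPath {p : ℕ ⊕ ℕ → ℝ} (hp : IsGoodPath p) (c : ℝ) {k : ℕ}
    {s u : ℝ} (hu : 0 ≤ u) (hus : u ≤ s) (hs : s < jumpTime p (k + 1)) :
    jumpPath c u (pastPath (s + 1) k p) = jumpPath c u p := by
  obtain ⟨j, hj1, hj2⟩ := hp.exists_mem_Ico hu
  have hjk : j ≤ k := by
    have := (strictMono_jumpTime hp.pos).lt_iff_lt.1 (hj1.trans_lt (hus.trans_lt hs))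
    omega
  rw [jumpPath_eq hp.pos c hj1 hj2, jumpPath_eq (k := j), jumpTime_pastPath _ hjk]
  · simp [pastPath, hjk]
  · intro i
    simp only [pastPath, Sum.elim_inl]
    split_ifs
    · exact hp.pos i
    · linarith
  · rwa [jumpTime_pastPath _ hjk]
  · rcases hjk.eq_or_lt with rfl | hlt
    · rw [jumpTime_succ, jumpTime_pastPath _ le_rfl]
      have := jumpTime_nonneg hp.pos j
      simp only [pastPath, Sum.elim_inl, lt_irrefl, if_false]
      linarith
    · rwa [jumpTime_pastPath _ hlt]

lemma measurable_jumpTime (k : ℕ) : Measurable fun p : ℕ ⊕ ℕ → ℝ => jumpTime p k := by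
  unfold jumpTime; fun_prop

lemma measurable_jumpCount : Measurable fun q : ℝ × (ℕ ⊕ ℕ → ℝ) => jumpCount q.2 q.1 := by
  refine Measurable.iSup fun k => Measurable.ite ?_ measurable_const measurable_const
  exact measurableSet_le ((measurable_jumpTime k).comp measurable_snd) measurable_fst

lemma measurable_jumpPath_uncurry {c : ℝ} (hc : 0 < c) :
    Measurable fun q : ℝ × (ℕ ⊕ ℕ → ℝ) => jumpPath c q.1 q.2 := by
  have h : Measurable fun z : ℕ × (ℝ × (ℕ ⊕ ℕ → ℝ)) =>
      z.2.2 (Sum.inr z.1) * flow c √c (z.2.1 - jumpTime z.2.2 z.1) := by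
    refine measurable_from_prod_countable_right fun k => ?_
    have h1 := (continuous_flow_right hc √c).measurable
    have h2 := measurable_jumpTime k
    change Measurable fun y : ℝ × (ℕ ⊕ ℕ → ℝ) =>
      y.2 (Sum.inr k) * flow c √c (y.1 - jumpTime y.2 k)
    exact ((measurable_pi_apply (Sum.inr k)).comp measurable_snd).mul
      (h1.comp (measurable_fst.sub (h2.comp measurable_snd)))
  exact h.comp (measurable_jumpCount.prodMk measurable_id)

lemma measurable_jumpPath {c : ℝ} (hc : 0 < c) (t : ℝ) : Measurable (jumpPath c t) :=
  (measurable_jumpPath_uncurry hc).comp measurable_prodMk_left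

lemma measurable_shiftPath (m : ℕ) : Measurable (shiftPath m) :=
  measurable_pi_lambda _ fun _ => measurable_pi_apply _

lemma measurable_pastPath (d : ℝ) (k : ℕ) : Measurable (pastPath d k) := by
  refine measurable_pi_lambda _ fun i => ?_
  rcases i with i | i <;> simp only [pastPath, Sum.elim_inl, Sum.elim_inr] <;> split_ifs <;> fun_prop

/-- An event of the past up to time `s`, on the event of exactly `k` jumps up to time `s`, is
determined by the data up to the `k`-th jump. -/
lemma exists_measurableSet_pastPath {c : ℝ} (hc : 0 < c) (s : ℝ≥0) (k : ℕ)
    {A : Set (ℕ ⊕ ℕ → ℝ)}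
    (hA : MeasurableSet[pastSigma (fun t : ℝ≥0 => jumpPath c t) s] A) :
    ∃ A' : Set (ℕ ⊕ ℕ → ℝ), MeasurableSet A' ∧ ∀ p, IsGoodPath p → s < jumpTime p (k + 1) →
      (p ∈ A ↔ pastPath (s + 1) k p ∈ A') := by
  let D := {p // IsGoodPath p ∧ (s : ℝ) < jumpTime p (k + 1)}
  let m' : MeasurableSpace (ℕ ⊕ ℕ → ℝ) := MeasurableSpace.map (Subtype.val : D → _)
    (MeasurableSpace.comap (fun p : D => pastPath (s + 1) k p.1) inferInstance)
  have hle : pastSigma (fun t : ℝ≥0 => jumpPath c t) s ≤ m' := by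
    refine iSup_le fun u => ?_
    rintro _ ⟨B, hB, rfl⟩
    refine ⟨jumpPath c u.1 ⁻¹' B, measurable_jumpPath hc _ hB, ?_⟩
    ext p
    simp only [Set.mem_preimage]
    rw [p.2.1.jumpPath_pastPath c u.1.coe_nonneg (NNReal.coe_le_coe.2 u.2) p.2.2]
  obtain ⟨A', hA', h⟩ := hle _ hA
  refine ⟨A', hA', fun p hp hs => ?_⟩
  have := congrArg (fun S => (⟨p, hp, hs⟩ : D) ∈ S) h
  simpa using this.symm

/-! ### The law of the renewal paths -/

/-- The law of the first jump time of the process started from `±√c`. -/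
def waitLaw (c : ℝ) : Measure ℝ :=
  (volume.restrict (Set.Ioi 0)).withDensity fun v => ENNReal.ofReal (jumpDensity c √c v)

/-- The law of a fair sign. -/
def signLaw : Measure ℝ := (1 / 2 : ENNReal) • Measure.dirac 1 + (1 / 2 : ENNReal) • Measure.dirac (-1)

/-- `Q` is the law of a sequence of waiting times and a sequence of fair signs, all independent. -/
structure IsPathLaw (c : ℝ) (Q : Measure (ℕ ⊕ ℕ → ℝ)) : Prop where
  isProbabilityMeasure : IsProbabilityMeasure Q
  indep : iIndepFun (fun (i : ℕ ⊕ ℕ) (p : ℕ ⊕ ℕ → ℝ) => p i) Q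
  wait : ∀ i, Q.map (fun p => p (Sum.inl i)) = waitLaw c
  sign : ∀ i, Q.map (fun p => p (Sum.inr i)) = signLaw

lemma Ioc_inter_Ioi_zero {s : ℝ} (hs : 0 ≤ s) (t : ℝ) :
    Set.Ioc s t ∩ Set.Ioi 0 = Set.Ioc s t :=
  Set.inter_eq_left.2 fun _ hv => Set.mem_Ioi.2 (hs.trans_lt hv.1)

lemma waitLaw_Ioc {c : ℝ} (hc : 0 < c) {s t : ℝ} (hs : 0 ≤ s) (hst : s ≤ t) :
    waitLaw c (Set.Ioc s t)
      = ENNReal.ofReal (Real.exp (-cumHazard c √c s) - Real.exp (-cumHazard c √c t)) := by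
  rw [waitLaw, withDensity_apply _ measurableSet_Ioc, Measure.restrict_restrict measurableSet_Ioc,
    Ioc_inter_Ioi_zero hs t, lintegral_jumpDensity hc _ hst]

lemma setLIntegral_waitLaw {c : ℝ} (hc : 0 < c) {s t : ℝ} (hs : 0 ≤ s) {f : ℝ → ENNReal}
    (hf : Measurable f) :
    ∫⁻ v in Set.Ioc s t, f v ∂(waitLaw c)
      = ∫⁻ v in Set.Ioc s t, ENNReal.ofReal (jumpDensity c √c v) * f v := by
  rw [waitLaw, restrict_withDensity measurableSet_Ioc, Measure.restrict_restrict measurableSet_Ioc,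
    Ioc_inter_Ioi_zero hs t,
    lintegral_withDensity_eq_lintegral_mul _ (measurable_ofReal_jumpDensity hc _) hf]
  rfl

lemma waitLaw_Ioi {c : ℝ} (hc : 0 < c) {s : ℝ} (hs : 0 ≤ s) :
    waitLaw c (Set.Ioi s) = ENNReal.ofReal (Real.exp (-cumHazard c √c s)) := by
  have h1 : Tendsto (fun n : ℕ => waitLaw c (Set.Ioc s (s + n))) atTop
      (𝓝 (waitLaw c (⋃ n : ℕ, Set.Ioc s (s + n)))) :=
    tendsto_measure_iUnion_atTop (s := fun n : ℕ => Set.Ioc s (s + n))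
      fun a b hab => Set.Ioc_subset_Ioc_right (by gcongr)
  have h2 : (⋃ n : ℕ, Set.Ioc s (s + n)) = Set.Ioi s := by
    ext x
    obtain ⟨n, hn⟩ := exists_nat_ge (x - s)
    simp only [Set.mem_iUnion, Set.mem_Ioc, Set.mem_Ioi]
    exact ⟨fun ⟨_, h⟩ => h.1, fun h => ⟨n, h, by linarith⟩⟩
  rw [h2] at h1
  have h3 : Tendsto (fun n : ℕ => ENNReal.ofReal
      (Real.exp (-cumHazard c √c s) - Real.exp (-cumHazard c √c (s + n)))) atTop
      (𝓝 (ENNReal.ofReal (Real.exp (-cumHazard c √c s) - 0))) := by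
    refine (ENNReal.continuous_ofReal.tendsto _).comp (tendsto_const_nhds.sub ?_)
    exact Real.tendsto_exp_neg_atTop_nhds_zero.comp ((cumHazard_tendsto_atTop hc _).comp
      (tendsto_atTop_add_const_left _ _ tendsto_natCast_atTop_atTop))
  rw [sub_zero] at h3
  refine tendsto_nhds_unique h1 (h3.congr fun n => ?_)
  rw [waitLaw_Ioc hc hs (by simp)]

lemma waitLaw_Iic_zero (c : ℝ) : waitLaw c (Set.Iic 0) = 0 := by
  rw [waitLaw, withDensity_apply _ measurableSet_Iic, Measure.restrict_restrict measurableSet_Iic,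
    Set.Iic_inter_Ioi, Set.Ioc_self, Measure.restrict_empty, lintegral_zero_measure]

lemma isProbabilityMeasure_waitLaw {c : ℝ} (hc : 0 < c) : IsProbabilityMeasure (waitLaw c) := by
  refine ⟨?_⟩
  rw [← Set.Iic_union_Ioi (a := (0 : ℝ)),
    measure_union (Set.Iic_disjoint_Ioi le_rfl) measurableSet_Ioi, waitLaw_Iic_zero,
    waitLaw_Ioi hc le_rfl]
  simp [hc]

lemma waitLaw_Iic_lt_one {c : ℝ} (hc : 0 < c) {s : ℝ} (hs : 0 ≤ s) :
    waitLaw c (Set.Iic s) < 1 := by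
  have := isProbabilityMeasure_waitLaw hc
  rw [← Set.compl_Ioi, prob_compl_eq_one_sub measurableSet_Ioi, waitLaw_Ioi hc hs]
  exact ENNReal.sub_lt_self ENNReal.one_ne_top one_ne_zero
    (ENNReal.ofReal_pos.2 (Real.exp_pos _)).ne'

/-- The law at time `w` of a path that has just jumped. -/
def freshKernel {c : ℝ} (hc : 0 < c) (Q : Measure (ℕ ⊕ ℕ → ℝ)) [SFinite Q] : Kernel ℝ ℝ where
  toFun w := Q.map (jumpPath c w)
  measurable' := by
    refine Measure.measurable_of_measurable_coe _ fun B hB => ?_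
    simp only [Measure.map_apply (measurable_jumpPath hc _) hB]
    exact measurable_measure_prodMk_left (measurable_jumpPath_uncurry hc hB)

lemma freshKernel_apply {c : ℝ} (hc : 0 < c) (Q : Measure (ℕ ⊕ ℕ → ℝ)) [SFinite Q] (w : ℝ) :
    freshKernel hc Q w = Q.map (jumpPath c w) := rfl

lemma indepFun_of_disjoint {Ω' ι α β : Type*} [MeasurableSpace Ω'] [mα : MeasurableSpace α]
    [mβ : MeasurableSpace β] {μ : Measure Ω'} {f : ι → Ω' → ℝ} (hf : ∀ i, Measurable (f i))
    (h : iIndepFun f μ) {S T : Set ι} (hST : Disjoint S T) {g : Ω' → α} {g' : Ω' → β}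
    (hg : Measurable[⨆ i ∈ S, MeasurableSpace.comap (f i) inferInstance] g)
    (hg' : Measurable[⨆ i ∈ T, MeasurableSpace.comap (f i) inferInstance] g') :
    IndepFun g g' μ := by
  rw [IndepFun_iff_Indep]
  exact indep_of_indep_of_le_left (indep_of_indep_of_le_right
    (indep_iSup_of_disjoint (fun i => (hf i).comap_le) h.iIndep hST) hg'.comap_le) hg.comap_le

lemma measurable_iSup_comap {Ω' ι : Type*} (f : ι → Ω' → ℝ) {S : Set ι} {i : ι} (hi : i ∈ S) :
    Measurable[⨆ i ∈ S, MeasurableSpace.comap (f i) inferInstance] (f i) :=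
  Measurable.of_comap_le (le_iSup₂ (f := fun i (_ : i ∈ S) =>
    MeasurableSpace.comap (f i) inferInstance) i hi)

lemma ae_signLaw {p : ℝ → Prop} (h1 : p 1) (h2 : p (-1)) : ∀ᵐ e ∂signLaw, p e := by
  have hd : ∀ x : ℝ, p x → ∀ᵐ e ∂(Measure.dirac x), p e := fun x hx => by
    rw [ae_dirac_eq]; exact hx
  rw [signLaw, ae_add_measure_iff]
  exact ⟨Measure.ae_smul_measure (hd 1 h1) _, Measure.ae_smul_measure (hd _ h2) _⟩

section

variable {c : ℝ} (hc : 0 < c) {Q : Measure (ℕ ⊕ ℕ → ℝ)} (hQ : IsPathLaw c Q)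
include hQ

lemma IsPathLaw.map_shiftPath (m : ℕ) : Q.map (shiftPath m) = Q := by
  have := hQ.isProbabilityMeasure
  have hinj : Function.Injective (Sum.map (m + ·) (m + ·) : ℕ ⊕ ℕ → ℕ ⊕ ℕ) :=
    Function.Injective.sumMap (add_right_injective m) (add_right_injective m)
  have h := IdentDistrib.pi (X := fun (i : ℕ ⊕ ℕ) (p : ℕ ⊕ ℕ → ℝ) => p (Sum.map (m + ·) (m + ·) i))
    (Y := fun (i : ℕ ⊕ ℕ) (p : ℕ ⊕ ℕ → ℝ) => p i) (μ := Q) (ν := Q) (fun i => ?_)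
    (hQ.indep.precomp hinj) hQ.indep
  · exact h.map_eq.trans Measure.map_id
  · refine ⟨(measurable_pi_apply _).aemeasurable, (measurable_pi_apply _).aemeasurable, ?_⟩
    rcases i with i | i
    · exact (hQ.wait _).trans (hQ.wait i).symm
    · exact (hQ.sign _).trans (hQ.sign i).symm

include hc in
/-- The data up to the `k`-th jump, the next waiting time and the later data are independent. -/
lemma IsPathLaw.lintegral_regeneration (d : ℝ) (k : ℕ)
    {F : (ℕ ⊕ ℕ → ℝ) → ℝ → (ℕ ⊕ ℕ → ℝ) → ENNReal}
    (hF : Measurable fun z : (ℕ ⊕ ℕ → ℝ) × ℝ × (ℕ ⊕ ℕ → ℝ) => F z.1 z.2.1 z.2.2) :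
    ∫⁻ p, F (pastPath d k p) (p (Sum.inl k)) (shiftPath (k + 1) p) ∂Q
      = ∫⁻ p, ∫⁻ w, ∫⁻ p', F (pastPath d k p) w p' ∂Q ∂(waitLaw c) ∂Q := by
  have := hQ.isProbabilityMeasure
  have := isProbabilityMeasure_waitLaw hc
  have hm1 := measurable_pastPath d k
  have hm2 : Measurable fun p : ℕ ⊕ ℕ → ℝ => p (Sum.inl k) := measurable_pi_apply _
  have hm3 := measurable_shiftPath (k + 1)
  have hi1 : IndepFun (fun p : ℕ ⊕ ℕ → ℝ => p (Sum.inl k)) (shiftPath (k + 1)) Q := by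
    refine indepFun_of_disjoint (f := fun i (p : ℕ ⊕ ℕ → ℝ) => p i)
      (S := {Sum.inl k}) (T := {Sum.inl k}ᶜ)
      (fun i => measurable_pi_apply i) hQ.indep disjoint_compl_right
      (measurable_iSup_comap (fun i (p : ℕ ⊕ ℕ → ℝ) => p i) rfl) ?_
    refine @measurable_pi_lambda _ _ _ (_) _ _ fun i => ?_
    refine measurable_iSup_comap (fun i (p : ℕ ⊕ ℕ → ℝ) => p i) ?_
    rcases i with i | i <;> simp; omega
  have hi2 : IndepFun (pastPath d k)
      (fun p : ℕ ⊕ ℕ → ℝ => (p (Sum.inl k), shiftPath (k + 1) p)) Q := by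
    refine indepFun_of_disjoint (f := fun i (p : ℕ ⊕ ℕ → ℝ) => p i)
      (S := {i | Sum.elim (· < k) (· ≤ k) i}) (T := {i | Sum.elim (· < k) (· ≤ k) i}ᶜ)
      (fun i => measurable_pi_apply i) hQ.indep disjoint_compl_right ?_ ?_
    · refine @measurable_pi_lambda _ _ _ (_) _ _ fun i => ?_
      rcases i with i | i <;> simp only [pastPath, Sum.elim_inl, Sum.elim_inr] <;> split_ifs with hi
      · exact measurable_iSup_comap (fun i (p : ℕ ⊕ ℕ → ℝ) => p i) hi
      · exact @measurable_const _ _ _ (_) _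
      · exact measurable_iSup_comap (fun i (p : ℕ ⊕ ℕ → ℝ) => p i) hi
      · exact @measurable_const _ _ _ (_) _
    · refine @Measurable.prodMk _ _ _ _ _ (_) _ _ ?_ ?_
      · exact measurable_iSup_comap (fun i (p : ℕ ⊕ ℕ → ℝ) => p i) (by simp)
      · refine @measurable_pi_lambda _ _ _ (_) _ _ fun i => ?_
        refine measurable_iSup_comap (fun i (p : ℕ ⊕ ℕ → ℝ) => p i) ?_
        rcases i with i | i <;> simp <;> omega
  have h1 := hi1.map_prod_eq_prod_map_map hm2.aemeasurable hm3.aemeasurable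
  have h2 := hi2.map_prod_eq_prod_map_map hm1.aemeasurable (hm2.prodMk hm3).aemeasurable
  rw [h1, hQ.wait, hQ.map_shiftPath] at h2
  have h3 := lintegral_map (μ := Q) hF (hm1.prodMk (hm2.prodMk hm3))
  rw [h2, lintegral_prod _ hF.aemeasurable, lintegral_map hF.lintegral_prod_right' hm1] at h3
  rw [← h3]
  refine lintegral_congr fun p => ?_
  exact lintegral_prod _ (hF.comp measurable_prodMk_left).aemeasurable

include hc in
lemma IsPathLaw.ae_isGoodPath : ∀ᵐ p ∂Q, IsGoodPath p := by
  have := hQ.isProbabilityMeasure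
  have hpos : ∀ᵐ p ∂Q, ∀ i, 0 < p (Sum.inl i) := by
    refine ae_all_iff.2 fun i => ?_
    have h : ∀ᵐ w ∂(waitLaw c), 0 < w := by
      rw [ae_iff]; simp only [not_lt]; exact waitLaw_Iic_zero c
    rw [← hQ.wait i] at h
    exact ae_of_ae_map (measurable_pi_apply _).aemeasurable h
  have hsign : ∀ᵐ p ∂Q, ∀ i, p (Sum.inr i) = 1 ∨ p (Sum.inr i) = -1 := by
    refine ae_all_iff.2 fun i => ?_
    have h : ∀ᵐ e ∂signLaw, e = 1 ∨ e = -1 := ae_signLaw (Or.inl rfl) (Or.inr rfl)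
    rw [← hQ.sign i] at h
    exact ae_of_ae_map (measurable_pi_apply _).aemeasurable h
  have hunb : ∀ᵐ p ∂Q, ∀ m : ℕ, ∃ i, (m : ℝ) < p (Sum.inl i) := by
    refine ae_all_iff.2 fun m => ?_
    rw [ae_iff]
    push Not
    have hle : ∀ K : ℕ, Q {p | ∀ i, p (Sum.inl i) ≤ m} ≤ waitLaw c (Set.Iic m) ^ K := fun K => by
      have h := hQ.indep.measure_inter_preimage_eq_mul
        ((Finset.range K).map Function.Embedding.inl) (sets := fun _ => Set.Iic (m : ℝ))
        (fun _ _ => measurableSet_Iic)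
      simp only [Finset.prod_map, Finset.mem_map, Finset.mem_range] at h
      have h2 : ∀ i : ℕ, Q ((fun p : ℕ ⊕ ℕ → ℝ => p (Sum.inl i)) ⁻¹' Set.Iic (m : ℝ))
          = waitLaw c (Set.Iic m) := fun i => by
        rw [← hQ.wait i, Measure.map_apply (measurable_pi_apply _) measurableSet_Iic]
      simp only [Function.Embedding.inl_apply, h2, Finset.prod_const, Finset.card_range] at h
      rw [← h]
      refine measure_mono fun p hp => ?_
      simp only [Set.mem_iInter, Set.mem_preimage, Set.mem_Iic]
      rintro _ ⟨i, _, rfl⟩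
      exact hp i
    exact le_antisymm (ge_of_tendsto' (ENNReal.tendsto_pow_atTop_nhds_zero_of_lt_one
      (waitLaw_Iic_lt_one hc (Nat.cast_nonneg m))) hle) bot_le
  filter_upwards [hpos, hsign, hunb] with p h1 h2 h3
  refine ⟨h1, fun x => ?_, h2⟩
  obtain ⟨m, hm⟩ := exists_nat_gt x
  obtain ⟨i, hi⟩ := h3 m
  refine ⟨i + 1, ?_⟩
  rw [jumpTime_succ]
  linarith [jumpTime_nonneg h1 i]

end

/-! ### The Markov property of the renewal paths -/

section

variable {c : ℝ} (hc : 0 < c)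
include hc

omit hc in
lemma flow_sign_mul {e : ℝ} (he : e = 1 ∨ e = -1) (x t : ℝ) :
    flow c (e * x) t = e * flow c x t := by
  rw [flow, flow, cumHazard_congr_sq (y := x) (by rcases he with rfl | rfl <;> ring), mul_assoc]

omit hc in
lemma jumpDensity_sign_mul {e : ℝ} (he : e = 1 ∨ e = -1) (x t : ℝ) :
    jumpDensity c (e * x) t = jumpDensity c x t := by
  rw [jumpDensity, jumpDensity, flow_sign_mul he,
    cumHazard_congr_sq (y := x) (by rcases he with rfl | rfl <;> ring), mul_pow]
  rcases he with rfl | rfl <;> simp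

lemma setLIntegral_Ioi_waitLaw (M : Kernel ℝ ℝ) {a t e : ℝ} (ha : 0 ≤ a) (ht : 0 ≤ t)
    (he : e = 1 ∨ e = -1) {B : Set ℝ} (hB : MeasurableSet B) :
    ∫⁻ w in Set.Ioi a, (if a + t < w then B.indicator 1 (e * flow c √c (a + t))
        else M (a + t - w) B) ∂(waitLaw c)
      = waitLaw c (Set.Ioi a) * transitionKernel hc M t (e * flow c √c a) B := by
  have h3 : Measurable fun v => M (a + t - v) B :=
    (Kernel.measurable_coe M hB).comp (by fun_prop : Measurable fun v => a + t - v)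
  have hη : ∀ v, cumHazard c (e * √c) v = cumHazard c √c v :=
    cumHazard_congr_sq (by rcases he with rfl | rfl <;> ring)
  have key := survival_mul_transitionKernel hc M (e * √c) a t hB
  simp only [flow_sign_mul he, jumpDensity_sign_mul he, hη] at key
  rw [waitLaw_Ioi hc ha, key, ← Set.Ioc_union_Ioi_eq_Ioi (by linarith : a ≤ a + t),
    lintegral_union measurableSet_Ioi (Set.Ioc_disjoint_Ioi le_rfl), add_comm]
  congr 1
  · rw [setLIntegral_congr_fun (g := fun _ => B.indicator 1 (e * flow c √c (a + t)))
      measurableSet_Ioi fun w hw => if_pos (Set.mem_Ioi.1 hw), setLIntegral_const,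
      waitLaw_Ioi hc (by positivity), mul_comm]
  · rw [setLIntegral_congr_fun (g := fun w => M (a + t - w) B)
      measurableSet_Ioc fun w hw => if_neg (not_lt.2 hw.2), setLIntegral_waitLaw hc ha h3]

lemma pastSigma_jumpPath_le (s : ℝ≥0) :
    pastSigma (fun t : ℝ≥0 => jumpPath c t) s ≤ MeasurableSpace.pi :=
  iSup_le fun _ => (measurable_jumpPath hc _).comap_le

variable {Q : Measure (ℕ ⊕ ℕ → ℝ)} [IsProbabilityMeasure Q] (hQ : IsPathLaw c Q)
include hQ

lemma setLIntegral_markov_of_jumpCount_eq (s t : ℝ≥0) (k : ℕ) {A : Set (ℕ ⊕ ℕ → ℝ)}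
    (hA : MeasurableSet[pastSigma (fun t : ℝ≥0 => jumpPath c t) s] A)
    {B : Set ℝ} (hB : MeasurableSet B) :
    ∫⁻ p in A ∩ {p | jumpCount p s = k}, B.indicator 1 (jumpPath c (s + t) p) ∂Q
      = ∫⁻ p in A ∩ {p | jumpCount p s = k},
          transitionKernel hc (freshKernel hc Q) t (jumpPath c s p) B ∂Q := by
  have := isProbabilityMeasure_waitLaw hc
  set M := freshKernel hc Q with hM
  obtain ⟨A', hA', hAA'⟩ := exists_measurableSet_pastPath hc s k hA
  have hS : MeasurableSet (A ∩ {p | jumpCount p s = k}) :=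
    (pastSigma_jumpPath_le hc s _ hA).inter
      ((measurable_jumpCount.comp measurable_prodMk_left) (measurableSet_singleton k))
  let C : Set ((ℕ ⊕ ℕ → ℝ) × ℝ × (ℕ ⊕ ℕ → ℝ)) :=
    {z | z.1 ∈ A' ∧ jumpTime z.1 k ≤ s ∧ s - jumpTime z.1 k < z.2.1}
  have hT : Measurable fun z : (ℕ ⊕ ℕ → ℝ) × ℝ × (ℕ ⊕ ℕ → ℝ) => s - jumpTime z.1 k :=
    measurable_const.sub ((measurable_jumpTime k).comp measurable_fst)
  have hsgn : Measurable fun z : (ℕ ⊕ ℕ → ℝ) × ℝ × (ℕ ⊕ ℕ → ℝ) => z.1 (Sum.inr k) :=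
    (measurable_pi_apply _).comp measurable_fst
  have hw : Measurable fun z : (ℕ ⊕ ℕ → ℝ) × ℝ × (ℕ ⊕ ℕ → ℝ) => z.2.1 :=
    measurable_fst.comp measurable_snd
  have hfl := (continuous_flow_right hc √c).measurable
  have h1B : Measurable (B.indicator (1 : ℝ → ENNReal)) := measurable_one.indicator hB
  have hC : MeasurableSet C :=
    (measurable_fst hA').inter ((measurableSet_le ((measurable_jumpTime k).comp measurable_fst)
      measurable_const).inter (measurableSet_lt hT hw))
  let G1 : (ℕ ⊕ ℕ → ℝ) × ℝ × (ℕ ⊕ ℕ → ℝ) → ENNReal := fun z =>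
    if s - jumpTime z.1 k + t < z.2.1
    then B.indicator 1 (z.1 (Sum.inr k) * flow c √c (s - jumpTime z.1 k + t))
    else B.indicator 1 (jumpPath c (s - jumpTime z.1 k + t - z.2.1) z.2.2)
  let G2 : (ℕ ⊕ ℕ → ℝ) × ℝ × (ℕ ⊕ ℕ → ℝ) → ENNReal := fun z =>
    transitionKernel hc M t (z.1 (Sum.inr k) * flow c √c (s - jumpTime z.1 k)) B
  have hG1 : Measurable G1 := by
    refine Measurable.ite (measurableSet_lt (hT.add_const _) hw)
      (h1B.comp (hsgn.mul (hfl.comp (hT.add_const _)))) (h1B.comp ?_)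
    exact (measurable_jumpPath_uncurry hc).comp
      (((hT.add_const _).sub hw).prodMk (measurable_snd.comp measurable_snd))
  have hG2 : Measurable G2 :=
    (Kernel.measurable_coe _ hB).comp (hsgn.mul (hfl.comp hT))
  have hmem : ∀ p, IsGoodPath p → (p ∈ A ∩ {p | jumpCount p s = k} ↔
      (pastPath (s + 1) k p, p (Sum.inl k), shiftPath (k + 1) p) ∈ C) := by
    intro p hp
    simp only [C, Set.mem_inter_iff, Set.mem_ofPred_eq, hp.jumpCount_eq_iff s.coe_nonneg,
      jumpTime_pastPath _ le_rfl, sub_lt_iff_lt_add', ← jumpTime_succ]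
    constructor
    · rintro ⟨h1, h2, h3⟩
      exact ⟨(hAA' p hp h3).1 h1, h2, h3⟩
    · rintro ⟨h1, h2, h3⟩
      exact ⟨(hAA' p hp h3).2 h1, h2, h3⟩
  have hsign : ∀ p, pastPath (s + 1) k p (Sum.inr k) = p (Sum.inr k) := fun p => by
    simp [pastPath]
  have hE1 : ∫⁻ p in A ∩ {p | jumpCount p s = k}, B.indicator 1 (jumpPath c (s + t) p) ∂Q
      = ∫⁻ p, C.indicator G1 (pastPath (s + 1) k p, p (Sum.inl k), shiftPath (k + 1) p) ∂Q := by
    rw [← lintegral_indicator hS]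
    refine lintegral_congr_ae ?_
    filter_upwards [hQ.ae_isGoodPath hc] with p hp
    by_cases hpS : p ∈ A ∩ {p | jumpCount p s = k}
    · rw [Set.indicator_of_mem hpS, Set.indicator_of_mem ((hmem p hp).1 hpS)]
      obtain ⟨h2, h3⟩ := (hp.jumpCount_eq_iff s.coe_nonneg k).1 hpS.2
      simp only [G1, hsign, jumpTime_pastPath _ le_rfl]
      have e1 : (s : ℝ) - jumpTime p k + t = s + t - jumpTime p k := by ring
      rw [e1]
      split_ifs with h4
      · rw [jumpPath_eq hp.pos c (k := k) (by linarith [t.coe_nonneg]) (by rw [jumpTime_succ]; linarith)]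
      · rw [hp.jumpPath_shiftPath c (m := k + 1) (by rw [jumpTime_succ]; linarith),
          jumpTime_succ, sub_sub]
    · rw [Set.indicator_of_notMem hpS, Set.indicator_of_notMem (fun h => hpS ((hmem p hp).2 h))]
  have hE2 : ∫⁻ p in A ∩ {p | jumpCount p s = k}, transitionKernel hc M t (jumpPath c s p) B ∂Q
      = ∫⁻ p, C.indicator G2 (pastPath (s + 1) k p, p (Sum.inl k), shiftPath (k + 1) p) ∂Q := by
    rw [← lintegral_indicator hS]
    refine lintegral_congr_ae ?_
    filter_upwards [hQ.ae_isGoodPath hc] with p hp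
    by_cases hpS : p ∈ A ∩ {p | jumpCount p s = k}
    · rw [Set.indicator_of_mem hpS, Set.indicator_of_mem ((hmem p hp).1 hpS)]
      obtain ⟨h2, h3⟩ := (hp.jumpCount_eq_iff s.coe_nonneg k).1 hpS.2
      simp only [G2, hsign, jumpTime_pastPath _ le_rfl]
      rw [jumpPath_eq hp.pos c h2 h3]
    · rw [Set.indicator_of_notMem hpS, Set.indicator_of_notMem (fun h => hpS ((hmem p hp).2 h))]
  rw [hE1, hE2, hQ.lintegral_regeneration hc (s + 1) k
      (F := fun m w p' => C.indicator G1 (m, w, p')) (hG1.indicator hC),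
    hQ.lintegral_regeneration hc (s + 1) k
      (F := fun m w p' => C.indicator G2 (m, w, p')) (hG2.indicator hC)]
  refine lintegral_congr_ae ?_
  filter_upwards [hQ.ae_isGoodPath hc] with p hp
  generalize hm : pastPath (s + 1) k p = m
  have he : m (Sum.inr k) = 1 ∨ m (Sum.inr k) = -1 := by rw [← hm, hsign]; exact hp.sign k
  by_cases hmA : m ∈ A' ∧ jumpTime m k ≤ s
  · have hind : ∀ (G : (ℕ ⊕ ℕ → ℝ) × ℝ × (ℕ ⊕ ℕ → ℝ) → ENNReal) w,
        ∫⁻ p', C.indicator G (m, w, p') ∂Q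
          = (Set.Ioi (s - jumpTime m k)).indicator (fun w => ∫⁻ p', G (m, w, p') ∂Q) w := by
      intro G w
      by_cases hw : w ∈ Set.Ioi (s - jumpTime m k)
      · rw [Set.indicator_of_mem hw]
        refine lintegral_congr fun p' => Set.indicator_of_mem ?_ _
        exact ⟨hmA.1, hmA.2, hw⟩
      · rw [Set.indicator_of_notMem hw, lintegral_congr (g := fun _ => 0)
          (fun p' => Set.indicator_of_notMem (fun h => hw h.2.2) _), lintegral_zero]
    simp only [hind, lintegral_indicator measurableSet_Ioi]
    have hI1 : ∀ w, ∫⁻ p', G1 (m, w, p') ∂Q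
        = if s - jumpTime m k + t < w
          then B.indicator 1 (m (Sum.inr k) * flow c √c (s - jumpTime m k + t))
          else M (s - jumpTime m k + t - w) B := by
      intro w
      simp only [G1]
      split_ifs with h
      · rw [lintegral_const, measure_univ, mul_one]
      · rw [hM, freshKernel_apply, ← lintegral_indicator_one hB,
          lintegral_map h1B (measurable_jumpPath hc _)]
    simp only [hI1]
    rw [setLIntegral_Ioi_waitLaw hc M (sub_nonneg.2 hmA.2) t.coe_nonneg he hB]
    simp only [G2, lintegral_const, measure_univ, mul_one, Measure.restrict_apply,
      MeasurableSet.univ, Set.univ_inter]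
    rw [mul_comm]
  · have hz : ∀ (G : (ℕ ⊕ ℕ → ℝ) × ℝ × (ℕ ⊕ ℕ → ℝ) → ENNReal) w p',
        C.indicator G (m, w, p') = 0 := fun G w p' =>
      Set.indicator_of_notMem (fun h => hmA ⟨h.1, h.2.1⟩) _
    simp only [hz]

/-- The Markov property of the renewal paths, in integrated form. -/
lemma setLIntegral_markov (s t : ℝ≥0) {A : Set (ℕ ⊕ ℕ → ℝ)}
    (hA : MeasurableSet[pastSigma (fun t : ℝ≥0 => jumpPath c t) s] A)
    {B : Set ℝ} (hB : MeasurableSet B) :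
    ∫⁻ p in A, transitionKernel hc (freshKernel hc Q) t (jumpPath c s p) B ∂Q
      = Q (A ∩ jumpPath c (s + t) ⁻¹' B) := by
  have hA0 := pastSigma_jumpPath_le hc s _ hA
  have hN : ∀ k, MeasurableSet (A ∩ {p | jumpCount p s = k}) := fun k =>
    hA0.inter ((measurable_jumpCount.comp measurable_prodMk_left) (measurableSet_singleton k))
  have hU : A = ⋃ k, A ∩ {p | jumpCount p s = k} := by
    ext p; simp
  have hdis : Pairwise (Function.onFun Disjoint fun k => A ∩ {p | jumpCount p s = k}) := by
    intro i j hij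
    refine Set.disjoint_left.2 fun p hi hj => hij ?_
    exact hi.2.symm.trans hj.2
  have h1 : ∫⁻ p in A, B.indicator 1 (jumpPath c (s + t) p) ∂Q
      = Q (A ∩ jumpPath c (s + t) ⁻¹' B) := by
    have hm := measurable_jumpPath hc (s + t) hB
    rw [Set.inter_comm, ← Measure.restrict_apply hm, ← lintegral_indicator_one hm]
    rfl
  rw [← h1, hU, lintegral_iUnion hN hdis, lintegral_iUnion hN hdis]
  exact tsum_congr fun k => (setLIntegral_markov_of_jumpCount_eq hc hQ s t k hA hB).symm

lemma lintegral_transitionKernel_freshKernel {s t : ℝ} (hs : 0 ≤ s) (ht : 0 ≤ t) {B : Set ℝ}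
    (hB : MeasurableSet B) :
    ∫⁻ y, transitionKernel hc (freshKernel hc Q) t y B ∂(freshKernel hc Q s)
      = freshKernel hc Q (s + t) B := by
  have h := setLIntegral_markov hc hQ ⟨s, hs⟩ ⟨t, ht⟩ MeasurableSet.univ hB
  rw [Measure.restrict_univ, Set.univ_inter] at h
  rw [freshKernel_apply, freshKernel_apply, Measure.map_apply (measurable_jumpPath hc _) hB,
    lintegral_map (Kernel.measurable_coe _ hB) (measurable_jumpPath hc _)]
  exact h

lemma isFreshLaw_freshKernel : IsFreshLaw c (freshKernel hc Q) where
  markov := ⟨fun w => (Measure.isProbabilityMeasure_map (measurable_jumpPath hc w).aemeasurable)⟩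
  locally_bounded T := by
    obtain ⟨R, hR⟩ := (isCompact_Icc (a := 0) (b := T)).exists_bound_of_continuousOn
      (continuous_flow_right hc √c).continuousOn
    refine ⟨R, fun w hw => ?_⟩
    rw [freshKernel_apply, ae_map_iff (measurable_jumpPath hc w).aemeasurable
      (measurableSet_le (by fun_prop) (by fun_prop))]
    filter_upwards [hQ.ae_isGoodPath hc] with p hp
    obtain ⟨k, hk1, hk2⟩ := hp.exists_mem_Ico hw.1
    have h0 := jumpTime_nonneg hp.pos k
    have h1 : |p (Sum.inr k)| = 1 := by rcases hp.sign k with h | h <;> simp [h]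
    rw [jumpPath_eq hp.pos c hk1 hk2, abs_mul, h1, one_mul]
    exact hR _ ⟨by linarith, by linarith [hw.2]⟩
  tendsto_zero g hg := by
    have hsgn : Measurable fun p : ℕ ⊕ ℕ → ℝ => p (Sum.inr 0) := measurable_pi_apply _
    obtain ⟨R, hR⟩ := (isCompact_Icc (a := 0) (b := 1)).exists_bound_of_continuousOn
      (continuous_flow_right hc √c).continuousOn
    obtain ⟨C, hC⟩ := (isCompact_Icc (a := -R) (b := R)).exists_bound_of_continuousOn
      hg.continuousOn
    have hlim : 1 / 2 * (g (-√c) + g √c) = ∫ p, g (p (Sum.inr 0) * √c) ∂Q := by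
      have hg' : Continuous fun e : ℝ => g (e * √c) := by fun_prop
      have h1 := integral_map (μ := Q) hsgn.aemeasurable
        (f := fun e : ℝ => g (e * √c)) hg'.aestronglyMeasurable
      rw [← h1, hQ.sign, signLaw, integral_add_measure, integral_smul_measure,
        integral_smul_measure, integral_dirac, integral_dirac]
      · simp; ring
      · exact (integrable_dirac (by simp)).smul_measure (by simp)
      · exact (integrable_dirac (by simp)).smul_measure (by simp)
    rw [hlim]
    simp only [freshKernel_apply]
    simp_rw [fun w : ℝ => integral_map (μ := Q) (measurable_jumpPath hc w).aemeasurable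
      (f := g) hg.aestronglyMeasurable]
    refine tendsto_integral_filter_of_dominated_convergence (fun _ => C) ?_ ?_
      (integrable_const _) ?_
    · exact Eventually.of_forall fun w =>
        (hg.measurable.comp (measurable_jumpPath hc w)).aestronglyMeasurable
    · filter_upwards [Icc_mem_nhdsGE one_pos] with w hw
      filter_upwards [hQ.ae_isGoodPath hc] with p hp
      obtain ⟨k, hk1, hk2⟩ := hp.exists_mem_Ico hw.1
      have h0 := jumpTime_nonneg hp.pos k
      have h1 : |p (Sum.inr k)| = 1 := by rcases hp.sign k with h | h <;> simp [h]
      refine hC _ (abs_le.1 ?_)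
      rw [jumpPath_eq hp.pos c hk1 hk2, abs_mul, h1, one_mul]
      exact hR _ ⟨by linarith, by linarith [hw.2]⟩
    · filter_upwards [hQ.ae_isGoodPath hc] with p hp
      have h1 : Tendsto (fun w => g (p (Sum.inr 0) * flow c √c w)) (𝓝[≥] 0)
          (𝓝 (g (p (Sum.inr 0) * √c))) := by
        have h2 : Continuous fun w => g (p (Sum.inr 0) * flow c √c w) :=
          hg.comp (continuous_const.mul (continuous_flow_right hc _))
        exact (h2.tendsto' 0 _ (by simp [hc])).mono_left nhdsWithin_le_nhds
      refine h1.congr' ?_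
      filter_upwards [Ico_mem_nhdsGE (hp.pos 0)] with w hw
      rw [jumpPath_eq hp.pos c (k := 0) (by rw [jumpTime_zero]; exact hw.1)
        (by rw [jumpTime_succ, jumpTime_zero, zero_add]; exact hw.2), jumpTime_zero, sub_zero]

end

/-! ### The rescaled renewal process -/

lemma clock_one_div_nat {n : ℕ} (hn : 1 ≤ n) (h : ℝ) :
    clock (1 / n) √(1 / n) h = clock 1 1 h / n := by
  have : (0 : ℝ) < n := by exact_mod_cast hn
  rw [clock, clock, Real.sq_sqrt (by positivity)]
  field_simp

lemma cumHazard_one_div_nat {n : ℕ} (hn : 1 ≤ n) (a : ℝ) :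
    cumHazard (1 / n) √(1 / n) (a / n) = cumHazard 1 1 a := by
  have hn' : (0 : ℝ) < 1 / n := by
    have : (0 : ℝ) < n := by exact_mod_cast hn
    positivity
  apply (strictMono_clock hn' √(1 / n)).injective
  rw [clock_cumHazard hn', clock_one_div_nat hn, clock_cumHazard one_pos]

lemma measurable_waiting :
    Measurable fun u : ℝ => -Real.log u + 1 / (2 * u ^ 2) - 1 / 2 := by
  fun_prop

lemma waitingLaw_Ioi {a : ℝ} (ha : 0 ≤ a) :
    waitingLaw (Set.Ioi a) = ENNReal.ofReal (Real.exp (-cumHazard 1 1 a)) := by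
  rw [waitingLaw, Measure.map_apply measurable_waiting measurableSet_Ioi,
    Measure.restrict_apply (measurable_waiting measurableSet_Ioi)]
  have h1 := survival_le_one one_pos 1 ha
  have key : (fun u : ℝ => -Real.log u + 1 / (2 * u ^ 2) - 1 / 2) ⁻¹' Set.Ioi a ∩ Set.Icc 0 1
      = Set.Ioo 0 (Real.exp (-cumHazard 1 1 a)) := by
    ext u
    simp only [Set.mem_inter_iff, Set.mem_preimage, Set.mem_Ioi, Set.mem_Icc, Set.mem_Ioo]
    rcases lt_trichotomy u 0 with hu | rfl | hu
    · exact ⟨fun h => absurd h.2.1 (not_le.2 hu), fun h => absurd h.1 (not_lt.2 hu.le)⟩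
    · constructor
      · intro h
        have := h.1
        simp at this
        linarith
      · intro h; exact absurd h.1 (lt_irrefl _)
    · have e1 : -Real.log u + 1 / (2 * u ^ 2) - 1 / 2 = clock 1 1 (-Real.log u) := by
        have : Real.exp (2 * -Real.log u) = (u ^ 2)⁻¹ := by
          rw [← Real.exp_log (by positivity : 0 < (u ^ 2)⁻¹), Real.log_inv, Real.log_pow]
          congr 1; push_cast; ring
        rw [clock, this]
        field_simp
        ring
      rw [e1, ← cumHazard_lt_iff one_pos, lt_neg, Real.log_lt_iff_lt_exp hu]
      constructor
      · exact fun h => ⟨hu, h.1⟩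
      · exact fun h => ⟨h.2, hu.le, (h.2.trans_le h1).le⟩
  rw [key, Real.volume_Ioo, sub_zero]

lemma eq_waitLaw {c : ℝ} (hc : 0 < c) (μ : Measure ℝ) [IsProbabilityMeasure μ]
    (h : ∀ s, 0 ≤ s → μ (Set.Ioi s) = ENNReal.ofReal (Real.exp (-cumHazard c √c s))) :
    μ = waitLaw c := by
  have := isProbabilityMeasure_waitLaw hc
  have h1 : ∀ s, 0 ≤ s → μ (Set.Iic s) = waitLaw c (Set.Iic s) := fun s hs => by
    rw [← Set.compl_Ioi, prob_compl_eq_one_sub measurableSet_Ioi,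
      prob_compl_eq_one_sub measurableSet_Ioi, h s hs, waitLaw_Ioi hc hs]
  refine Measure.ext_of_Iic _ _ fun s => ?_
  rcases le_total 0 s with hs | hs
  · exact h1 s hs
  · rw [measure_mono_null (Set.Iic_subset_Iic.2 hs) (waitLaw_Iic_zero c),
      measure_mono_null (Set.Iic_subset_Iic.2 hs) ((h1 0 le_rfl).trans (waitLaw_Iic_zero c))]

lemma eq_signLaw (μ : Measure ℝ) [IsProbabilityMeasure μ] (h1 : μ {1} = 1 / 2)
    (h2 : μ {-1} = 1 / 2) : μ = signLaw := by
  have hd : Disjoint ({1} : Set ℝ) {-1} := by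
    rw [Set.disjoint_singleton]; norm_num
  have hU : μ ({1} ∪ {-1}) = 1 := by
    rw [measure_union hd (measurableSet_singleton _), h1, h2, ENNReal.add_halves]
  have hae : ∀ᵐ x ∂μ, x ∈ ({1} ∪ {-1} : Set ℝ) :=
    (mem_ae_iff_prob_eq_one ((measurableSet_singleton _).union (measurableSet_singleton _))).2 hU
  rw [← Measure.restrict_eq_self_of_ae_mem hae, Measure.restrict_union hd
    (measurableSet_singleton _), Measure.restrict_singleton, Measure.restrict_singleton, h1, h2,
    signLaw]

variable {Ω : Type*} [MeasurableSpace Ω]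

/-- The rescaled waiting times and the signs. -/
def renewalData (X ε : ℕ → Ω → ℝ) (n : ℕ) (ω : Ω) : ℕ ⊕ ℕ → ℝ :=
  Sum.elim (fun i => X i ω / n) (fun i => ε i ω)

omit [MeasurableSpace Ω] in
lemma jumpTime_renewalData (X ε : ℕ → Ω → ℝ) (n k : ℕ) (ω : Ω) :
    jumpTime (renewalData X ε n ω) k = renewalTime X k ω / n := by
  simp [jumpTime, renewalData, renewalTime, Finset.sum_div]

omit [MeasurableSpace Ω] in
lemma renewalTime_le_iff (X ε : ℕ → Ω → ℝ) {n : ℕ} (hn : 1 ≤ n) (t : ℝ≥0) (k : ℕ) (ω : Ω) :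
    renewalTime X k ω ≤ ((n * t : ℝ≥0) : ℝ) ↔ jumpTime (renewalData X ε n ω) k ≤ t := by
  have : (0 : ℝ) < n := by exact_mod_cast hn
  rw [jumpTime_renewalData, div_le_iff₀ this, mul_comm (t : ℝ)]
  simp

omit [MeasurableSpace Ω] in
lemma renewalCount_eq (X ε : ℕ → Ω → ℝ) {n : ℕ} (hn : 1 ≤ n) (t : ℝ≥0) (ω : Ω) :
    renewalCount X (n * t) ω = jumpCount (renewalData X ε n ω) t := by
  rw [renewalCount, jumpCount, iSup]
  congr 1
  ext k
  simp only [Set.mem_ofPred_eq, Set.mem_range, renewalTime_le_iff X ε hn]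
  constructor
  · exact fun h => ⟨k, if_pos h⟩
  · rintro ⟨j, hj⟩
    split_ifs at hj with h
    · rwa [← hj]
    · rw [← hj, jumpTime_zero]; exact t.coe_nonneg

omit [MeasurableSpace Ω] in
lemma renewalTime_renewalCount_le (X : ℕ → Ω → ℝ) (t : ℝ≥0) (ω : Ω) :
    renewalTime X (renewalCount X t ω) ω ≤ t := by
  have h0 : (0 : ℕ) ∈ {k : ℕ | renewalTime X k ω ≤ t} := by simp [renewalTime]
  by_cases hb : BddAbove {k : ℕ | renewalTime X k ω ≤ t}
  · exact Nat.sSup_mem ⟨0, h0⟩ hb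
  · rw [renewalCount, Nat.sSup_of_not_bddAbove hb]
    exact h0

section

variable {P : Measure Ω} {X ε : ℕ → Ω → ℝ} (hXε : IsRenewalInput P X ε)
include hXε

lemma IsRenewalInput.rescaledZ_eq {n : ℕ} (hn : 1 ≤ n) (t : ℝ≥0) (ω : Ω) :
    rescaledZ P X ε n t ω = jumpPath (1 / n) t (renewalData X ε n ω) := by
  have hn0 : (0 : ℝ) < n := by exact_mod_cast hn
  have hle := renewalTime_renewalCount_le X (n * t) ω
  have htail : ∀ a : ℝ, 0 ≤ a → tailProb P X a = Real.exp (-cumHazard 1 1 a) := fun a ha => by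
    have h := waitingLaw_Ioi ha
    rw [← hXε.law_waiting 0, Measure.map_apply (hXε.measurable_waiting 0) measurableSet_Ioi] at h
    rw [tailProb, measureReal_def, ← ENNReal.toReal_ofReal (Real.exp_nonneg _), ← h]
    rfl
  rw [rescaledZ, renewalZ, htail _ (sub_nonneg.2 hle), jumpPath, ← renewalCount_eq X ε hn,
    jumpTime_renewalData, flow]
  have e1 : (t : ℝ) - renewalTime X (renewalCount X (n * t) ω) ω / n
      = (((n * t : ℝ≥0) : ℝ) - renewalTime X (renewalCount X (n * t) ω) ω) / n := by
    push_cast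
    field_simp
  rw [e1, cumHazard_one_div_nat hn, Real.exp_neg, div_inv_eq_mul, Real.sqrt_div zero_le_one,
    Real.sqrt_one]
  simp only [renewalData, Sum.elim_inr]
  ring

lemma IsRenewalInput.measurable_renewalData (n : ℕ) : Measurable (renewalData X ε n) := by
  refine measurable_pi_lambda _ fun i => ?_
  rcases i with i | i
  · exact (hXε.measurable_waiting i).div_const _
  · exact hXε.measurable_sign i

lemma IsRenewalInput.isPathLaw [IsProbabilityMeasure P] {n : ℕ} (hn : 1 ≤ n) :
    IsPathLaw (1 / n) (P.map (renewalData X ε n)) := by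
  have hn0 : (0 : ℝ) < n := by exact_mod_cast hn
  have hm := hXε.measurable_renewalData n
  have hmi : ∀ i, Measurable fun ω => renewalData X ε n ω i := fun i =>
    (measurable_pi_apply i).comp hm
  have hprob : IsProbabilityMeasure (P.map (renewalData X ε n)) :=
    Measure.isProbabilityMeasure_map hm.aemeasurable
  have hind : iIndepFun (fun i ω => renewalData X ε n ω i) P := by
    have h := hXε.indep.comp (fun i x => Sum.elim (fun _ => x / n) (fun _ => x) i) (fun i => by
      rcases i with i | i <;> simp only [Sum.elim_inl, Sum.elim_inr] <;> fun_prop)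
    convert h using 1
    ext i ω
    rcases i with i | i <;> rfl
  have hmap : ∀ i, (P.map (renewalData X ε n)).map (fun p => p i)
      = P.map fun ω => renewalData X ε n ω i := fun i =>
    Measure.map_map (measurable_pi_apply i) hm
  refine ⟨hprob, ?_, fun i => ?_, fun i => ?_⟩
  · rw [iIndepFun_iff_map_fun_eq_infinitePi_map (fun i => measurable_pi_apply i)]
    simp only [hmap]
    exact Measure.map_id.trans (hind.map_fun_eq_infinitePi_map hmi)
  · rw [hmap]
    have := Measure.isProbabilityMeasure_map (μ := P) (hmi (Sum.inl i)).aemeasurable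
    refine eq_waitLaw (by positivity) _ fun s hs => ?_
    rw [Measure.map_apply (hmi _) measurableSet_Ioi]
    have h := waitingLaw_Ioi (a := n * s) (by positivity)
    rw [← hXε.law_waiting i, Measure.map_apply (hXε.measurable_waiting i) measurableSet_Ioi,
      ← cumHazard_one_div_nat hn, mul_div_cancel_left₀ _ hn0.ne'] at h
    rw [← h]
    congr 1
    ext ω
    simp only [Set.mem_preimage, Set.mem_Ioi, renewalData, Sum.elim_inl]
    rw [lt_div_iff₀ hn0, mul_comm]
  · rw [hmap]
    have := Measure.isProbabilityMeasure_map (μ := P) (hmi (Sum.inr i)).aemeasurable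
    refine eq_signLaw _ ?_ ?_
    · rw [Measure.map_apply (hmi _) (measurableSet_singleton _)]
      exact hXε.sign_pos i
    · rw [Measure.map_apply (hmi _) (measurableSet_singleton _)]
      exact hXε.sign_neg i

end

omit [MeasurableSpace Ω] in
lemma pastSigma_comp {Ω' E : Type*} [MeasurableSpace Ω'] [MeasurableSpace E]
    (Y : ℝ≥0 → Ω' → E) (f : Ω → Ω') (s : ℝ≥0) :
    pastSigma (fun t ω => Y t (f ω)) s = (pastSigma Y s).comap f := by
  simp only [pastSigma, MeasurableSpace.comap_iSup, MeasurableSpace.comap_comp]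
  rfl

/-- To check a Markov property it is enough to integrate over the events of the past. -/
lemma isMarkovProcess_of_setLIntegral {P : Measure Ω} [IsProbabilityMeasure P]
    {E : Type*} [MeasurableSpace E] {Y : ℝ≥0 → Ω → E} {κ : ℝ≥0 → Kernel E E}
    (hY : ∀ t, Measurable (Y t)) (hκ : IsTransitionSemigroup κ)
    (h : ∀ (s t : ℝ≥0) (A : Set Ω), MeasurableSet[pastSigma Y s] A → ∀ B : Set E,
      MeasurableSet B → ∫⁻ ω in A, κ t (Y s ω) B ∂P = P (A ∩ Y (s + t) ⁻¹' B)) :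
    IsMarkovProcess P Y κ where
  measurable := hY
  semigroup := hκ
  markov_property s t B hB := by
    have hκt := hκ.markov t
    have hle : pastSigma Y s ≤ _ := iSup_le fun u => (hY u).comap_le
    have hYs : Measurable[pastSigma Y s] (Y s) :=
      Measurable.of_comap_le (le_iSup (fun u : Set.Iic s => MeasurableSpace.comap (Y u) _)
        ⟨s, Set.self_mem_Iic⟩)
    have hB' := hY (s + t) hB
    have hgm : Measurable[pastSigma Y s] fun ω => (κ t (Y s ω)).real B :=
      ((Kernel.measurable_coe (κ t) hB).comp hYs).ennreal_toReal
    have hbd : ∀ ω, ‖(κ t (Y s ω)).real B‖ ≤ 1 := fun ω => by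
      rw [Real.norm_of_nonneg measureReal_nonneg]; exact measureReal_le_one
    refine (ae_eq_condExp_of_forall_setIntegral_eq hle
      ((integrable_const (1 : ℝ)).indicator hB') (fun A _ _ => ?_) (fun A hA _ => ?_)
      hgm.aestronglyMeasurable).symm
    · exact (Integrable.of_bound (hgm.mono hle le_rfl).aestronglyMeasurable 1
        (ae_of_all _ hbd)).integrableOn
    · rw [setIntegral_indicator hB', setIntegral_const, smul_eq_mul, mul_one, measureReal_def,
        ← h s t A hA B hB, ← integral_toReal]
      · rfl
      · exact ((Kernel.measurable_coe (κ t) hB).comp (hY s)).aemeasurable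
      · exact ae_of_all _ fun ω => measure_lt_top _ _

end AzemaRenewal

end

open AzemaRenewal in
theorem corollary1 {Ω : Type*} [MeasurableSpace Ω] (P : Measure Ω) [IsProbabilityMeasure P]
    (X ε : ℕ → Ω → ℝ) (hXε : IsRenewalInput P X ε) (n : ℕ) (hn : 1 ≤ n) :
    ∃ κ : ℝ≥0 → Kernel ℝ ℝ,
      IsMarkovProcess P (rescaledZ P X ε n) κ ∧
      IsFeller κ ∧
      (∀ g h : C₀(ℝ, ℝ), InGeneratorGraph κ g h ↔
        (∀ x : ℝ, x ≠ 0 → DifferentiableAt ℝ g x) ∧ ∀ x : ℝ, h x = genL n g x) ∧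
      (∀ g : ℝ → ℝ, Differentiable ℝ g → ∀ x : ℝ,
        (∀ t : ℝ≥0, Integrable g (κ t x)) ∧
        Tendsto (fun t : ℝ≥0 => ((∫ y, g y ∂(κ t x)) - g x) / (t : ℝ)) (𝓝[>] 0)
          (𝓝 (genL n g x))) := by
  have hn0 : (0 : ℝ) < n := by exact_mod_cast hn
  have hc : (0 : ℝ) < 1 / n := by positivity
  have hm := hXε.measurable_renewalData n
  have hQ := hXε.isPathLaw hn
  have := hQ.isProbabilityMeasure
  set Q := P.map (renewalData X ε n)
  have hM := isFreshLaw_freshKernel hc hQ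
  have := hM.markov
  have hsqrt : 1 / √(n : ℝ) = √(1 / (n : ℝ)) := by rw [Real.sqrt_div zero_le_one, Real.sqrt_one]
  refine ⟨fun t => transitionKernel hc (freshKernel hc Q) t, ?_, isFeller_transitionKernel hc hM,
    fun g h => ?_, fun g hg x => ⟨fun t => ?_, ?_⟩⟩
  · have hZ : rescaledZ P X ε n = fun (t : ℝ≥0) ω => jumpPath (1 / n) t (renewalData X ε n ω) := by
      ext t ω; exact hXε.rescaledZ_eq hn t ω
    rw [hZ]
    refine isMarkovProcess_of_setLIntegral (fun t => (measurable_jumpPath hc t).comp hm)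
      ⟨fun t => isMarkovKernel_transitionKernel hc _ t.coe_nonneg, transitionKernel_zero hc _,
        fun s t => transitionKernel_add hc _
          (fun s t hs ht B hB => lintegral_transitionKernel_freshKernel hc hQ hs ht hB)
          s.coe_nonneg t.coe_nonneg⟩ fun s t A hA B hB => ?_
    rw [pastSigma_comp (fun t : ℝ≥0 => jumpPath (1 / n) t)] at hA
    obtain ⟨A', hA', rfl⟩ := hA
    have hA0 := pastSigma_jumpPath_le hc s _ hA'
    have key := setLIntegral_markov hc hQ s t hA' hB
    exact (setLIntegral_map hA0 ((Kernel.measurable_coe _ hB).comp (measurable_jumpPath hc s))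
      hm).symm.trans (key.trans
        (Measure.map_apply hm (hA0.inter (measurable_jumpPath hc _ hB))))
  · rw [inGeneratorGraph_transitionKernel_iff hc hM]
    simp only [genL, hsqrt]
  · exact integrable_transitionKernel hc hM hg.continuous t.coe_nonneg x
  · simp only [genL, hsqrt]
    exact tendsto_transition_quotient hc hM hg x
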